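/- **Proposition (Multi-scale fundamental bound).** Let $d,D\in\mathbb N$, $m>0$, $M>1$. Let $T=\mathrm U(1)^D$ (additive angle coordinates $\theta\in(\mathbb R/2\pi\mathbb Z)^D$, normalized Haar measure $\mathrm dh$), equipped with a translation-invariant Riemannian metric, and let $K_\alpha$ be its heat kernel, i.e. the kernel of $e^{\alpha\Delta}$ with respect to $\mathrm dh$. *Graphs.* A graph $\mathcal G$ of the rank-$d$ complex tensorial model consists of finite sets of white and black nodes, a perfect matching (the lines of color $\ell$) between white and black nodes for each color $\ell=1,\dots,d$, and a finite set of lines (of color $0$), each joining a white to a black node, with at most one line at each node; nodes without a line carry external legs. The faces of color $\ell$ are the maximal alternating circuits (closed faces) or paths (open faces) of lines of colors $0$ and $\ell$ that pass through at least one line of color $0$. Orient lines and faces arbitrarily; $\epsilon_{ef}=\pm1$ if the face $f$ passes through the line $e$ with the same/opposite orientation, and $0$ otherwise. Each open face $f$ carries a source boundary variable $g_{s(f)}\in T$ and a target boundary variable $g_{t(f)}\in T$. *Amplitudes.* A scale attribution is a map $\mu=\{i_e\}$ from the lines to $\{0,\dots,\rho\}$. Let $I_0=[1,\infty)$ and $I_i=[M^{-2i},M^{-2(i-1)}]$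 for $i\ge1$, and put $\alpha(f)=\sum_{e\in f}\alpha_e$. The amplitude is $$\mathcal A_{\mathcal G,\mu}(g_s,g_t)=\Big[\prod_{e}\int_{I_{i_e}}\mathrm d\alpha_e\,e^{-m^2\alpha_e}\int_T\mathrm dh_e\Big]\prod_{f\ \mathrm{closed}}K_{\alpha(f)}\Big(\sum_{e}\epsilon_{ef}h_e\Big)\prod_{f\ \mathrm{open}}K_{\alpha(f)}\Big(g_{s(f)}+\sum_{e}\epsilon_{ef}h_e-g_{t(f)}\Big).$$ *Divergence degree.* For a set $\mathcal H$ of lines, the internal faces of $\mathcal H$ are the closed faces of $\mathcal G$ passing only through lines of $\mathcal H$. Let $L(\mathcal H)$ and $F(\mathcal H)$ be the numbers of lines and internal faces, $r(\mathcal H)$ the rank of the matrix $\epsilon_{ef}$ ($e\in\mathcal H$, $f$ internal to $\mathcal H$), and $$\omega(\mathcal H)=-2L(\mathcal H)+D\big(F(\mathcal H)-r(\mathcal H)\big).$$ The connected components of $\mathcal H$ are the classes of the equivalence relation on its lines generated by "lying on a common internal face of $\mathcal H$". Let $\mathcal G_i$ be the set of lines with $i_e\ge i$ and $\mathcal G_i^{(1)},\dots,\mathcal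 G_i^{(k(i))}$ its connected components (the nodes of the Gallavotti–Nicolò tree). *Claim.* There is a constant $K>0$, depending only on $d,D,m,M$ and the metric, such that for every graph $\mathcal G$, every $\rho\in\mathbb N$, every scale attribution $\mu$ with scales in $\{0,\dots,\rho\}$, and all values of the source variables $g_s$, the integral defining $\mathcal A_{\mathcal G,\mu}(g_s,g_t)$ converges absolutely for every $g_t$, the amplitude is integrable in $g_t$, and $$\int\big|\mathcal A_{\mathcal G,\mu}(g_s,g_t)\big|\prod_{f\ \mathrm{open}}\mathrm dg_{t(f)}\;\le\;K^{L(\mathcal G)}\prod_{i=0}^{\rho}\ \prod_{k=1}^{k(i)}M^{\omega(\mathcal G_i^{(k)})}.$$ In particular, if $\mathcal G$ has no open face, then $|\mathcal A_{\mathcal G,\mu}|\le K^{L(\mathcal G)}\prod_i\prod_k M^{\omega(\mathcal G_i^{(k)})}$; in general the same bound holds for the amplitude tested against any measurable function of the target variables bounded by $1$. -/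

import Mathlib

open MeasureTheory

noncomputable section

/-! ### Tensorial graphs, their faces and their subgraphs -/

/-- A Feynman graph of a rank-`d` complex tensorial field theory, given by its colored extension.
The `d`-bubbles (vertices) are the connected components of the `d`-colored bipartite graph with
white nodes `White` (fields `φ`), black nodes `Black` (fields `φ̄`), in which every node carries
exactly one colored line of each color `ℓ`; the color-`ℓ` lines are the pairs
`(w, bubbleEdge ℓ w)`.  The (internal) lines of the graph are the color-`0` lines; each links a
white node to a black node, and each node is attached to at most one of them.  Nodes attached to no
line carry an external leg. -/
structure TensorGraph (d : ℕ) where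
  White : Type
  Black : Type
  Line : Type
  [finWhite : Fintype White]
  [finBlack : Fintype Black]
  [finLine : Fintype Line]
  bubbleEdge : Fin d → White ≃ Black
  white : Line ↪ White
  black : Line ↪ Black

attribute [instance] TensorGraph.finWhite TensorGraph.finBlack TensorGraph.finLine

namespace TensorGraph

variable {d : ℕ} (G : TensorGraph d)

/-- In the color-`(0, ℓ)` strand that runs through the line `e` from its white to its black end and
then along the color-`ℓ` line attached to that black end, the next line is `e'`. -/
def Next (ℓ : Fin d) (e e' : G.Line) : Prop :=
  G.bubbleEdge ℓ (G.white e') = G.black e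

/-- A face of color `ℓ` passing through at least one line: a maximal alternating circuit or path of
lines of colors `0` and `ℓ`, i.e. a class for the equivalence relation on lines generated
by `Next ℓ`. -/
def Face : Type := Σ ℓ : Fin d, Quot (G.Next ℓ)

instance : Finite G.Face :=
  inferInstanceAs (Finite (Σ ℓ : Fin d, Quot (G.Next ℓ)))

instance : Fintype G.Face := Fintype.ofFinite _

variable {G}

/-- The face `f` passes through the line `e`. -/
def Face.Through (f : G.Face) (e : G.Line) : Prop := Quot.mk (G.Next f.1) e = f.2

/-- A face is closed if its strand never ends at an external leg (it is then a circuit). -/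
def Face.IsClosed (f : G.Face) : Prop := ∀ e, f.Through e → ∃ e', G.Next f.1 e e'

variable (G)

/-- The closed faces of the graph. -/
abbrev ClosedFace : Type := {f : G.Face // f.IsClosed}

/-- The open faces of the graph (passing through at least one line). -/
abbrev OpenFace : Type := {f : G.Face // ¬ f.IsClosed}

instance : Fintype G.ClosedFace := Fintype.ofFinite _

instance : Fintype G.OpenFace := Fintype.ofFinite _

/-- An arbitrary orientation of the lines and of the faces.  Because the colored extension is
bipartite, a face runs through all of its lines from white to black, or through all of them from
black to white; the signs say whether a line (a face) is oriented in the white-to-black way. -/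
structure Orientation where
  line : G.Line → ℤˣ
  face : G.Face → ℤˣ

variable {G}

open scoped Classical in
/-- The incidence matrix `ε_{ef}`: `+1` if the face `f` goes through the line `e` with the same
orientation, `-1` if it does so with the opposite orientation, `0` otherwise. -/
def Orientation.incidence (o : G.Orientation) : Matrix G.Line G.Face ℤ :=
  fun e f => if f.Through e then (o.line e : ℤ) * (o.face f : ℤ) else 0

/-- Internal faces of a subgraph (a set of lines) `H`: the closed faces of `G` which pass only
through lines of `H`. -/
abbrev InternalFace (H : Finset G.Line) : Type :=
  {f : G.Face // f.IsClosed ∧ ∀ e, f.Through e → e ∈ H}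

instance (H : Finset G.Line) : Fintype (InternalFace H) := Fintype.ofFinite _

/-- The rank `r(H)` of the incidence matrix between the lines and the internal faces of `H`. -/
def Orientation.rank (o : G.Orientation) (H : Finset G.Line) : ℕ :=
  (Matrix.of fun (e : H) (f : InternalFace H) => (o.incidence e.1 f.1 : ℚ)).rank

/-- The Abelian divergence degree `ω(H) = -2 L(H) + D (F(H) - r(H))`. -/
def Orientation.divergenceDegree (o : G.Orientation) (D : ℕ) (H : Finset G.Line) : ℤ :=
  -2 * (H.card : ℤ) + (D : ℤ) * ((Fintype.card (InternalFace H) : ℤ) - (o.rank H : ℤ))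

/-- Elementary connection of two lines in a subgraph `H`: a common internal face of `H`. -/
def ShareFace (H : Finset G.Line) (e e' : G.Line) : Prop :=
  ∃ f : InternalFace H, f.1.Through e ∧ f.1.Through e'

open scoped Classical in
/-- The connected components of a subgraph `H`: the sets of lines of the blocks into which the
incidence matrix of `H` (lines against internal faces) decomposes.  A line of `H` in no internal
face of `H` is a component by itself. -/
def components (H : Finset G.Line) : Finset (Finset G.Line) :=
  H.image fun e => H.filter fun e' => Relation.ReflTransGen (ShareFace H) e e'

/-- `G_i`: the subgraph made of all lines of scale at least `i`. -/
def highPart (μ : G.Line → ℕ) (i : ℕ) : Finset G.Line :=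
  Finset.univ.filter fun e => i ≤ μ e

end TensorGraph

/-! ### The heat kernel of a compact connected abelian Lie group -/

instance TensorGraph.factTwoPiPos : Fact (0 < 2 * Real.pi) := ⟨Real.two_pi_pos⟩

/-- The compact connected abelian Lie group `U(1)^D`, in angle coordinates. -/
abbrev Torus (D : ℕ) : Type := Fin D → AddCircle (2 * Real.pi)

/-- Normalized Haar measure. -/
def torusHaar (D : ℕ) : Measure (Torus D) :=
  Measure.pi fun _ => AddCircle.haarAddCircle

/-- The heat kernel `K_α`, the kernel of `exp(α Δ)` with respect to normalized Haar measure,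
where `Δ` is the Laplace-Beltrami operator of the translation-invariant Riemannian metric
`∑ Q j k dθ_j dθ_k`: the sum of the Gaussian kernel over all real lifts of the angles `θ`. -/
def heatKernel {D : ℕ} (Q : Matrix (Fin D) (Fin D) ℝ) (α : ℝ) (θ : Torus D) : ℝ :=
  (2 * Real.pi) ^ D * Real.sqrt Q.det / Real.sqrt ((4 * Real.pi * α) ^ D) *
    ∑' x : {x : Fin D → ℝ // ∀ j, ((x j : ℝ) : AddCircle (2 * Real.pi)) = θ j},
      Real.exp (-(x.1 ⬝ᵥ Q.mulVec x.1) / (4 * α))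

/-! ### Sliced amplitudes -/

/-- The range of the Schwinger parameter in the slice `i`: `[1, ∞)` for `i = 0`, and
`[M^{-2i}, M^{-2(i-1)}]` for `i ≥ 1`. -/
def schwingerSlice (M : ℝ) : ℕ → Set ℝ
  | 0 => Set.Ici 1
  | i + 1 => Set.Icc ((M ^ (2 * (i + 1)))⁻¹) ((M ^ (2 * i))⁻¹)

namespace TensorGraph

variable {d : ℕ} {G : TensorGraph d} {D : ℕ}

open scoped Classical in
/-- `α(f)`: the sum of the Schwinger parameters of the lines of the face `f`. -/
def Face.alpha (f : G.Face) (α : G.Line → ℝ) : ℝ :=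
  ∑ e ∈ Finset.univ.filter f.Through, α e

/-- The holonomy `∏_{e ∈ ∂f} h_e^{ε_{ef}}`, written additively. -/
def Orientation.holonomy (o : G.Orientation) (f : G.Face) (h : G.Line → Torus D) : Torus D :=
  ∑ e, o.incidence e f • h e

/-- The integrand of the amplitude, as a function of the Schwinger parameters and of the group
elements `(α, h)` of the lines.  Every open face `f` has a source boundary variable `gs f` and a
target boundary variable `gt f`. -/
def Orientation.integrand (o : G.Orientation) (Q : Matrix (Fin D) (Fin D) ℝ) (m : ℝ)
    (gs gt : G.OpenFace → Torus D) (p : (G.Line → ℝ) × (G.Line → Torus D)) : ℝ :=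
  (∏ e, Real.exp (-(m ^ 2 * p.1 e))) *
    (∏ f : G.ClosedFace, heatKernel Q (f.1.alpha p.1) (o.holonomy f.1 p.2)) *
    ∏ f : G.OpenFace, heatKernel Q (f.1.alpha p.1) (gs f + o.holonomy f.1 p.2 - gt f)

/-- Integration over the Schwinger parameters `α_e` in the slices `μ e` and over the group
elements `h_e`. -/
def lineMeasure (G : TensorGraph d) (D : ℕ) (M : ℝ) (μ : G.Line → ℕ) :
    Measure ((G.Line → ℝ) × (G.Line → Torus D)) :=
  (Measure.pi fun e => volume.restrict (schwingerSlice M (μ e))).prod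
    (Measure.pi fun _ => torusHaar D)

/-- The amplitude `A_{G,μ}` at scale attribution `μ`, as a function of the boundary variables. -/
def Orientation.amplitude (o : G.Orientation) (Q : Matrix (Fin D) (Fin D) ℝ) (m M : ℝ)
    (μ : G.Line → ℕ) (gs gt : G.OpenFace → Torus D) : ℝ :=
  ∫ p, o.integrand Q m gs gt p ∂(lineMeasure G D M μ)

end TensorGraph

end

/-!
Every heat kernel is nonnegative, so the amplitude is integrated by Tonelli's theorem, and each kernel
can be used in one of two ways: bounded by its supremum, or integrated over a group variable.

Two facts on the kernel `K_α` suffice (`exists_heatKernel_le`, `exists_lintegral_heatKernel_le`): it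
is `O(b ^ D)` for `α ≥ b⁻²`, `b ≥ 1`, and its mass is bounded uniformly in `α`. Since a positive
definite form dominates a multiple of the Euclidean one, both reduce to periodized Gaussians on the
circle, where the first follows from the functional equation of the theta series and the second from
unfolding the integral over the circle into a Gaussian integral over the line.

An open face is integrated over its target variable. Among the closed faces a set `R` with linearly
independent rows in the incidence matrix is selected. The homomorphism which maps the line variables
to the holonomies of the faces in `R` is surjective, hence pushes Haar measure forward to Haar
measure (`measurePreserving_holonomyHom`), and the kernels of these faces are integrated out at
bounded cost each. The kernel of a closed face `f` outside `R` is bounded by its supremum: `α(f)` is at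
least the Schwinger parameter of a line of `f` of smallest scale `s(f)`, hence at least
`M ^ (-2 s(f))`, so that the kernel is `O(M ^ (D s(f)))`. A line `e` contributes the length of its slice,
of order `M ^ (-2 μ(e))`. The number of faces is at most `d L`, so that all constants are absorbed
into `K ^ L`.

It remains to compare `-2 ∑ μ(e) + D ∑_{f ∉ R} s(f)` with the sum of the divergence degrees over the
Gallavotti-Nicolò tree. The set `R` is chosen greedily from high to low scales, which makes its
members inside `G_i` span all internal faces of `G_i` for every `i`
(`exists_linearIndepOn_span_filtration`). The incidence matrix of `G_i` is block diagonal along the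
components, so `R` has at least `r(C)` members in each component `C` (`Orientation.rank_component_le`),
and summation over `i` and `C` gives the bound
(`Orientation.exists_linearIndepOn_power_counting`).
-/

noncomputable section

/-! ### Periodized Gaussians on the circle -/

/-- The Gaussian `exp (-s x²)` summed over all real lifts `x` of the angle `y`. -/
def circleTheta (s : ℝ) (y : AddCircle (2 * Real.pi)) : ENNReal :=
  ∑' x : {x : ℝ // (x : AddCircle (2 * Real.pi)) = y}, ENNReal.ofReal (Real.exp (-(s * x.1 ^ 2)))

/-- The real lifts of an angle, enumerated from one of them. -/
def liftEquiv (x : ℝ) (y : AddCircle (2 * Real.pi)) (h : (x : AddCircle (2 * Real.pi)) = y) :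
    ℤ ≃ {x : ℝ // (x : AddCircle (2 * Real.pi)) = y} :=
  Equiv.ofBijective (fun n => ⟨x + n * (2 * Real.pi), by
      rw [← h, ← zsmul_eq_mul, AddCircle.coe_add, AddCircle.coe_zsmul, AddCircle.coe_period,
        smul_zero, add_zero]⟩) <| by
    constructor
    · intro a b hab
      have := congrArg Subtype.val hab
      simpa [Real.pi_ne_zero] using this
    · rintro ⟨z, hz⟩
      have h1 : ((z - x : ℝ) : AddCircle (2 * Real.pi)) = 0 := by
        rw [AddCircle.coe_sub, hz, h, sub_self]
      obtain ⟨n, hn⟩ := (AddCircle.coe_eq_zero_iff _).1 h1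
      refine ⟨n, Subtype.ext ?_⟩
      simp only [zsmul_eq_mul] at hn
      simp only [hn]
      ring

/-- The representative in `(-π, π]` of an angle. -/
def angleRep (y : AddCircle (2 * Real.pi)) : ℝ :=
  (AddCircle.measurableEquivIoc (2 * Real.pi) (-Real.pi) y : ℝ)

theorem measurable_angleRep : Measurable angleRep :=
  measurable_subtype_coe.comp (AddCircle.measurableEquivIoc (2 * Real.pi) (-Real.pi)).measurable

theorem coe_angleRep (y : AddCircle (2 * Real.pi)) : (angleRep y : AddCircle (2 * Real.pi)) = y :=
  (AddCircle.equivIoc (2 * Real.pi) (-Real.pi)).symm_apply_apply y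

theorem abs_angleRep_le (y : AddCircle (2 * Real.pi)) : |angleRep y| ≤ Real.pi := by
  have h := (AddCircle.measurableEquivIoc (2 * Real.pi) (-Real.pi) y).2
  rw [abs_le]
  exact ⟨h.1.le, by have := h.2; unfold angleRep; linarith⟩

theorem circleTheta_eq_tsum_int (s x : ℝ) (y : AddCircle (2 * Real.pi))
    (h : (x : AddCircle (2 * Real.pi)) = y) :
    circleTheta s y =
      ∑' n : ℤ, ENNReal.ofReal (Real.exp (-(s * (x + n * (2 * Real.pi)) ^ 2))) :=
  ((liftEquiv x y h).tsum_eq _).symm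

theorem measurable_circleTheta (s : ℝ) : Measurable (circleTheta s) := by
  have : circleTheta s = fun y =>
      ∑' n : ℤ, ENNReal.ofReal (Real.exp (-(s * (angleRep y + n * (2 * Real.pi)) ^ 2))) :=
    funext fun y => circleTheta_eq_tsum_int s _ y (coe_angleRep y)
  rw [this]
  have := measurable_angleRep
  exact Measurable.tsum fun n => by fun_prop

/-- Unfolding the integral over the circle into a Gaussian integral over the line. -/
theorem lintegral_circleTheta {s : ℝ} (hs : 0 < s) :
    ∫⁻ y, circleTheta s y ∂AddCircle.haarAddCircle =
      ENNReal.ofReal (Real.sqrt (Real.pi / s) / (2 * Real.pi)) := by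
  have hpi := Real.two_pi_pos
  have h1 : ∫⁻ y : AddCircle (2 * Real.pi), circleTheta s y
      = ENNReal.ofReal (Real.sqrt (Real.pi / s)) := by
    rw [← AddCircle.lintegral_preimage (2 * Real.pi) 0]
    have h2 : ∀ a : ℝ, circleTheta s (a : AddCircle (2 * Real.pi)) =
        ∑' n : ℤ, ENNReal.ofReal (Real.exp (-(s * (a + n * (2 * Real.pi)) ^ 2))) :=
      fun a => circleTheta_eq_tsum_int s a _ rfl
    simp_rw [h2]
    rw [lintegral_tsum fun n => by fun_prop]
    have h3 : ∀ n : ℤ, ∫⁻ a in Set.Ioc 0 (0 + 2 * Real.pi),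
          ENNReal.ofReal (Real.exp (-(s * (a + n * (2 * Real.pi)) ^ 2)))
        = ∫⁻ a in Set.Ioc (0 + n • (2 * Real.pi)) (0 + (n + 1) • (2 * Real.pi)),
          ENNReal.ofReal (Real.exp (-(s * a ^ 2))) := by
      intro n
      have h := (measurePreserving_add_right volume
        ((n : ℝ) * (2 * Real.pi))).setLIntegral_comp_preimage
        (measurableSet_Ioc (a := 0 + n • (2 * Real.pi)) (b := 0 + (n + 1) • (2 * Real.pi)))
        (f := fun a => ENNReal.ofReal (Real.exp (-(s * a ^ 2)))) (by fun_prop)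
      rw [← h]
      congr 2
      ext a
      simp only [Set.mem_Ioc, Set.mem_preimage, zsmul_eq_mul, Int.cast_add, Int.cast_one]
      constructor <;> rintro ⟨h, h'⟩ <;> constructor <;> linarith
    simp_rw [h3]
    rw [← lintegral_iUnion (fun n => measurableSet_Ioc)
      (by exact Set.pairwise_disjoint_Ioc_add_zsmul (0 : ℝ) (2 * Real.pi)),
      iUnion_Ioc_add_zsmul hpi, Measure.restrict_univ]
    have h4 := integrable_exp_neg_mul_sq hs
    have h5 := integral_gaussian s
    simp only [neg_mul] at h4 h5
    rw [← h5, ofReal_integral_eq_lintegral_ofReal h4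
      (Filter.Eventually.of_forall fun x => (Real.exp_pos _).le)]
  have h6 := AddCircle.volume_eq_smul_haarAddCircle (T := 2 * Real.pi)
  rw [h6, lintegral_smul_measure, smul_eq_mul] at h1
  rw [ENNReal.ofReal_div_of_pos hpi, ENNReal.eq_div_iff (by simpa using hpi) ENNReal.ofReal_ne_top, h1]

/-- The value of the theta series `∑ exp (-π n²)`. -/
def thetaOne : ℝ := ∑' n : ℤ, Real.exp (-Real.pi * (n : ℝ) ^ 2)

theorem summable_exp_neg_mul_int_sq {a : ℝ} (ha : 0 < a) :
    Summable fun n : ℤ => Real.exp (-Real.pi * a * (n : ℝ) ^ 2) := by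
  have h := ((summable_jacobiTheta₂_term_iff 0 (Complex.I * a)).2 (by simpa using ha)).norm
  refine h.congr fun n => ?_
  rw [norm_jacobiTheta₂_term]
  congr 1
  simp
  ring

theorem summable_thetaOne : Summable fun n : ℤ => Real.exp (-Real.pi * (n : ℝ) ^ 2) := by
  simpa using summable_exp_neg_mul_int_sq one_pos

theorem one_le_thetaOne : 1 ≤ thetaOne := by
  have := summable_thetaOne.le_tsum 0 fun n _ => (Real.exp_pos _).le
  simpa [thetaOne] using this

/-- The functional equation of the theta series turns small parameters into large ones. -/
theorem tsum_exp_neg_mul_int_sq_le {a : ℝ} (ha : 0 < a) :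
    ∑' n : ℤ, Real.exp (-Real.pi * a * (n : ℝ) ^ 2) ≤ thetaOne * (1 + 1 / Real.sqrt a) := by
  have hmono : ∀ b : ℝ, 1 ≤ b →
      ∑' n : ℤ, Real.exp (-Real.pi * b * (n : ℝ) ^ 2) ≤ thetaOne := by
    intro b hb
    refine (summable_exp_neg_mul_int_sq (by linarith)).tsum_le_tsum (fun n => ?_) summable_thetaOne
    refine Real.exp_le_exp.2 ?_
    have : 0 ≤ Real.pi * (n : ℝ) ^ 2 * (b - 1) :=
      mul_nonneg (mul_nonneg Real.pi_pos.le (sq_nonneg _)) (by linarith)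
    linarith
  have h1 := one_le_thetaOne
  have hs := Real.sqrt_pos.2 ha
  rcases le_total 1 a with h | h
  · refine (hmono a h).trans (le_mul_of_one_le_right (by linarith) ?_)
    have := one_div_pos.2 hs
    linarith
  · rw [Real.tsum_exp_neg_mul_int_sq ha, ← Real.sqrt_eq_rpow]
    have h2 := hmono (1 / a) (by rw [le_div_iff₀ ha]; linarith)
    have h3 : ∀ n : ℤ, -Real.pi / a * (n : ℝ) ^ 2 = -Real.pi * (1 / a) * (n : ℝ) ^ 2 :=
      fun n => by ring
    simp_rw [h3]
    have := mul_le_mul_of_nonneg_left h2 (one_div_pos.2 hs).le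
    linarith

/-- The periodized Gaussian is at most of the order of its mass once the Gaussian is wider than the
circle, and bounded otherwise. -/
theorem circleTheta_le {s : ℝ} (hs : 0 < s) (y : AddCircle (2 * Real.pi)) :
    circleTheta s y ≤ ENNReal.ofReal (thetaOne * (1 + 1 / Real.sqrt (s * Real.pi))) := by
  have hpi := Real.pi_pos
  have ha : 0 < s * Real.pi := mul_pos hs hpi
  refine le_trans ?_ (ENNReal.ofReal_le_ofReal (tsum_exp_neg_mul_int_sq_le ha))
  rw [circleTheta_eq_tsum_int s _ y (coe_angleRep y),
    ENNReal.ofReal_tsum_of_nonneg (fun n => (Real.exp_pos _).le) (summable_exp_neg_mul_int_sq ha)]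
  refine ENNReal.tsum_le_tsum fun n => ENNReal.ofReal_le_ofReal (Real.exp_le_exp.2 ?_)
  set x := angleRep y
  have hx := abs_le.1 (abs_angleRep_le y)
  -- a lift of the angle in the `n`-th period is at distance at least `π |n|` from the origin
  have key : Real.pi ^ 2 * (n : ℝ) ^ 2 ≤ (x + n * (2 * Real.pi)) ^ 2 := by
    rw [← mul_pow, ← sq_abs, ← sq_abs (x + _)]
    refine pow_le_pow_left₀ (abs_nonneg _) ?_ 2
    rcases lt_trichotomy n 0 with h | h | h
    · have h' : (n : ℝ) ≤ -1 := by exact_mod_cast Int.le_sub_one_of_lt h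
      refine le_abs.2 (Or.inr ?_)
      rw [abs_of_nonpos (by nlinarith)]
      nlinarith
    · simp [h]
    · have h' : (1 : ℝ) ≤ n := by exact_mod_cast h
      refine le_abs.2 (Or.inl ?_)
      rw [abs_of_nonneg (by positivity)]
      nlinarith
  have := mul_le_mul_of_nonneg_left key hs.le
  linarith

/-! ### The heat kernel of the torus -/

/-- No summability is needed: a divergent real sum has the value `0`. -/
theorem ENNReal.ofReal_tsum_le {ι : Type*} {f : ι → ℝ} (hf : ∀ i, 0 ≤ f i) :
    ENNReal.ofReal (∑' i, f i) ≤ ∑' i, ENNReal.ofReal (f i) := by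
  have h := ENNReal.tsum_toReal_eq (f := fun i => ENNReal.ofReal (f i))
    fun _ => ENNReal.ofReal_ne_top
  simp_rw [ENNReal.toReal_ofReal (hf _)] at h
  rw [← h]
  exact ENNReal.ofReal_toReal_le

/-- A sum of products over a product of index types is a product of sums. -/
theorem ENNReal.tsum_pi_prod {n : ℕ} {A : Fin n → Type} (g : ∀ j, A j → ENNReal) :
    ∑' x : ∀ j, A j, ∏ j, g j (x j) = ∏ j, ∑' a, g j a := by
  induction n with
  | zero => simp
  | succ n ih =>
    rw [← (Fin.consEquiv A).tsum_eq]
    simp only [Fin.consEquiv_apply, Fin.prod_univ_succ, Fin.cons_zero, Fin.cons_succ]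
    rw [ENNReal.tsum_prod
      (f := fun (a : A 0) (b : ∀ i : Fin n, A i.succ) => g 0 a * ∏ i : Fin n, g i.succ (b i))]
    simp_rw [ENNReal.tsum_mul_left, ih (fun i => g i.succ), ENNReal.tsum_mul_right]

theorem heatKernel_nonneg {D : ℕ} (Q : Matrix (Fin D) (Fin D) ℝ) (α : ℝ) (θ : Torus D) :
    0 ≤ heatKernel Q α θ := by
  have := Real.pi_pos
  exact mul_nonneg (by positivity) (tsum_nonneg fun x => (Real.exp_pos _).le)

/-- The heat kernel as a sum over the lattice of periods. -/
theorem heatKernel_eq_tsum_int {D : ℕ} (Q : Matrix (Fin D) (Fin D) ℝ) (α : ℝ) (θ : Torus D) :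
    heatKernel Q α θ =
      (2 * Real.pi) ^ D * Real.sqrt Q.det / Real.sqrt ((4 * Real.pi * α) ^ D) *
        (∑' n : Fin D → ℤ, ENNReal.ofReal (Real.exp
          (-((fun j => angleRep (θ j) + n j * (2 * Real.pi)) ⬝ᵥ
            Q.mulVec (fun j => angleRep (θ j) + n j * (2 * Real.pi))) / (4 * α)))).toReal := by
  rw [ENNReal.tsum_toReal_eq fun _ => ENNReal.ofReal_ne_top, heatKernel]
  congr 1
  let E : (Fin D → ℤ) ≃ {x : Fin D → ℝ // ∀ j, ((x j : ℝ) : AddCircle (2 * Real.pi)) = θ j} :=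
    (Equiv.piCongrRight fun j => liftEquiv _ (θ j) (coe_angleRep (θ j))).trans
      Equiv.subtypePiEquivPi.symm
  rw [← E.tsum_eq]
  refine tsum_congr fun n => ?_
  rw [ENNReal.toReal_ofReal (Real.exp_pos _).le]
  rfl

/-- Joint measurability holds for all real `α`, as the sum over lifts is the real value of a sum in
`ENNReal`, whether or not it converges. -/
theorem measurable_heatKernel {D : ℕ} (Q : Matrix (Fin D) (Fin D) ℝ) :
    Measurable fun p : ℝ × Torus D => heatKernel Q p.1 p.2 := by
  simp_rw [heatKernel_eq_tsum_int]
  have h := measurable_angleRep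
  refine Measurable.mul (by fun_prop) (Measurable.ennreal_toReal (Measurable.tsum fun n => ?_))
  simp only [dotProduct, Matrix.mulVec]
  fun_prop

/-- A positive definite quadratic form dominates a multiple of the Euclidean one. -/
theorem Matrix.PosDef.exists_mul_sum_sq_le {D : ℕ} {Q : Matrix (Fin D) (Fin D) ℝ}
    (hQ : Q.PosDef) : ∃ c : ℝ, 0 < c ∧ ∀ x : Fin D → ℝ, c * ∑ j, x j ^ 2 ≤ x ⬝ᵥ Q.mulVec x := by
  have hcont : Continuous fun x : Fin D → ℝ => x ⬝ᵥ Q.mulVec x := by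
    simp only [dotProduct, Matrix.mulVec]
    fun_prop
  have hscale : ∀ (t : ℝ) (x : Fin D → ℝ),
      (t • x) ⬝ᵥ Q.mulVec (t • x) = t ^ 2 * (x ⬝ᵥ Q.mulVec x) := by
    intro t x
    rw [Matrix.mulVec_smul, smul_dotProduct, dotProduct_smul, smul_eq_mul, smul_eq_mul]
    ring
  let S : Set (Fin D → ℝ) := {x | ∑ j, x j ^ 2 = 1}
  have hS : IsCompact S := by
    refine Metric.isCompact_of_isClosed_isBounded
      (isClosed_eq (by fun_prop) continuous_const) ?_
    refine (Metric.isBounded_closedBall (x := (0 : Fin D → ℝ)) (r := 1)).subset fun x hx => ?_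
    rw [mem_closedBall_zero_iff, pi_norm_le_iff_of_nonneg zero_le_one]
    intro j
    have h : x j ^ 2 ≤ 1 := by
      rw [← show ∑ j, x j ^ 2 = 1 from hx]
      exact Finset.single_le_sum (f := fun j => x j ^ 2) (fun _ _ => sq_nonneg _)
        (Finset.mem_univ j)
    rw [Real.norm_eq_abs]
    exact (sq_le_one_iff_abs_le_one _).1 h
  have hpos : ∀ x ∈ S, 0 < x ⬝ᵥ Q.mulVec x := by
    intro x hx
    have hx0 : x ≠ 0 := by
      rintro rfl
      simp [S] at hx
    simpa using hQ.dotProduct_mulVec_pos hx0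
  obtain ⟨c, hc, hcS⟩ : ∃ c : ℝ, 0 < c ∧ ∀ x ∈ S, c ≤ x ⬝ᵥ Q.mulVec x := by
    rcases S.eq_empty_or_nonempty with h | h
    · exact ⟨1, one_pos, by simp [h]⟩
    · obtain ⟨x, hx, hmin⟩ := hS.exists_isMinOn h hcont.continuousOn
      exact ⟨_, hpos x hx, fun y hy => hmin hy⟩
  refine ⟨c, hc, fun x => ?_⟩
  have h0 : 0 ≤ ∑ j, x j ^ 2 := Finset.sum_nonneg fun _ _ => sq_nonneg _
  rcases h0.eq_or_lt with h | h
  · rw [← h, mul_zero]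
    simpa using hQ.posSemidef.dotProduct_mulVec_nonneg x
  · set r := Real.sqrt (∑ j, x j ^ 2) with hr
    have hr0 : 0 < r := Real.sqrt_pos.2 h
    have hr2 : r ^ 2 = ∑ j, x j ^ 2 := Real.sq_sqrt h0
    have hmem : r⁻¹ • x ∈ S := by
      simp only [S, Set.mem_ofPred_eq, Pi.smul_apply, smul_eq_mul, mul_pow, ← Finset.mul_sum, ← hr2]
      rw [← mul_pow, inv_mul_cancel₀ hr0.ne', one_pow]
    have := hcS _ hmem
    rw [hscale, inv_pow, inv_mul_eq_div, le_div_iff₀ (by positivity)] at this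
    rwa [← hr2]

/-- Comparison of the heat kernel with a product of periodized Gaussians, one for each angle. -/
theorem heatKernel_le_prod_circleTheta {D : ℕ} (Q : Matrix (Fin D) (Fin D) ℝ) {c : ℝ}
    (hc : ∀ x : Fin D → ℝ, c * ∑ j, x j ^ 2 ≤ x ⬝ᵥ Q.mulVec x) {α : ℝ} (hα : 0 < α)
    (θ : Torus D) :
    ENNReal.ofReal (heatKernel Q α θ) ≤
      ENNReal.ofReal ((2 * Real.pi) ^ D * Real.sqrt Q.det) *
        ∏ j, (ENNReal.ofReal (1 / Real.sqrt (4 * Real.pi * α)) *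
          circleTheta (c / (4 * α)) (θ j)) := by
  have hpi := Real.pi_pos
  have hsq : Real.sqrt ((4 * Real.pi * α) ^ D) = Real.sqrt (4 * Real.pi * α) ^ D :=
    Real.sqrt_eq_iff_mul_self_eq (by positivity) (by positivity) |>.2 <| by
      rw [← mul_pow, Real.mul_self_sqrt (by positivity)]
  rw [heatKernel, hsq, div_eq_mul_one_div, mul_assoc, ENNReal.ofReal_mul (by positivity),
    Finset.prod_mul_distrib, Finset.prod_const, Finset.card_univ, Fintype.card_fin,
    ← ENNReal.ofReal_pow (by positivity), one_div_pow]
  gcongr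
  rw [ENNReal.ofReal_mul (by positivity)]
  gcongr
  refine (ENNReal.ofReal_tsum_le fun x => (Real.exp_pos _).le).trans ?_
  simp only [circleTheta]
  rw [← ENNReal.tsum_pi_prod (A := fun j => {x : ℝ // (x : AddCircle (2 * Real.pi)) = θ j})
    (g := fun j x => ENNReal.ofReal (Real.exp (-(c / (4 * α) * x.1 ^ 2)))),
    ← Equiv.subtypePiEquivPi.tsum_eq]
  refine ENNReal.tsum_le_tsum fun x => ?_
  rw [← ENNReal.ofReal_prod_of_nonneg fun _ _ => (Real.exp_pos _).le, ← Real.exp_sum]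
  refine ENNReal.ofReal_le_ofReal (Real.exp_le_exp.2 ?_)
  rw [Finset.sum_neg_distrib, ← Finset.mul_sum, neg_div, neg_le_neg_iff, div_mul_eq_mul_div]
  exact div_le_div_of_nonneg_right (hc x.1) (by positivity)

/-- The heat kernel at time at least `b⁻²`, with `b ≥ 1`, is at most of order `b ^ D`. -/
theorem exists_heatKernel_le {D : ℕ} {Q : Matrix (Fin D) (Fin D) ℝ} (hQ : Q.PosDef) :
    ∃ C : ℝ, 1 ≤ C ∧ ∀ α b : ℝ, 1 ≤ b → (b ^ 2)⁻¹ ≤ α → ∀ θ : Torus D,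
      heatKernel Q α θ ≤ C * b ^ D := by
  obtain ⟨c, hc, hcQ⟩ := hQ.exists_mul_sum_sq_le
  have hpi := Real.pi_pos
  have ht := one_le_thetaOne
  set C₁ := thetaOne * (1 + 2 / Real.sqrt (c * Real.pi)) with hC₁
  have hC₁0 : 0 ≤ C₁ := by positivity
  refine ⟨max 1 ((2 * Real.pi) ^ D * Real.sqrt Q.det * C₁ ^ D), le_max_left _ _,
    fun α b hb hα θ => ?_⟩
  have hb0 : 0 < b := by linarith
  have hα0 : 0 < α := lt_of_lt_of_le (by positivity) hα
  have hsα : 1 / Real.sqrt α ≤ b := by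
    rw [div_le_iff₀ (Real.sqrt_pos.2 hα0)]
    have : b⁻¹ ≤ Real.sqrt α := Real.le_sqrt_of_sq_le (by rwa [inv_pow])
    calc 1 = b * b⁻¹ := (mul_inv_cancel₀ hb0.ne').symm
      _ ≤ _ := by gcongr
  have hfac : ∀ j, ENNReal.ofReal (1 / Real.sqrt (4 * Real.pi * α)) *
      circleTheta (c / (4 * α)) (θ j) ≤ ENNReal.ofReal (C₁ * b) := by
    intro j
    refine (mul_le_mul_right (circleTheta_le (by positivity) _) _).trans ?_
    rw [← ENNReal.ofReal_mul (by positivity)]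
    refine ENNReal.ofReal_le_ofReal ?_
    have e1 : Real.sqrt (c / (4 * α) * Real.pi) = Real.sqrt (c * Real.pi) / (2 * Real.sqrt α) := by
      rw [show c / (4 * α) * Real.pi = (c * Real.pi) / (2 ^ 2 * α) by ring,
        Real.sqrt_div (by positivity), Real.sqrt_mul (by positivity) α, Real.sqrt_sq (by positivity)]
    have e2 : Real.sqrt (4 * Real.pi * α) = Real.sqrt (4 * Real.pi) * Real.sqrt α :=
      Real.sqrt_mul (by positivity) _
    have h4 : 1 ≤ Real.sqrt (4 * Real.pi) :=
      Real.one_le_sqrt.2 (by linarith [Real.pi_gt_three])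
    have hsα0 := Real.sqrt_pos.2 hα0
    have hsc : 0 < Real.sqrt (c * Real.pi) := Real.sqrt_pos.2 (by positivity)
    have h5 : 1 / Real.sqrt (4 * Real.pi) ≤ 1 := by rw [div_le_one (by linarith)]; exact h4
    rw [e1, e2]
    calc 1 / (Real.sqrt (4 * Real.pi) * Real.sqrt α) *
          (thetaOne * (1 + 1 / (Real.sqrt (c * Real.pi) / (2 * Real.sqrt α))))
        = 1 / Real.sqrt (4 * Real.pi) *
          (thetaOne * (1 / Real.sqrt α + 2 / Real.sqrt (c * Real.pi))) := by
          field_simp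
      _ ≤ 1 * (thetaOne * (b + 2 / Real.sqrt (c * Real.pi) * b)) := by
          gcongr
          exact le_mul_of_one_le_right (by positivity) hb
      _ = C₁ * b := by rw [hC₁]; ring
  have h := (heatKernel_le_prod_circleTheta Q hcQ hα0 θ).trans
    (mul_le_mul_right (Finset.prod_le_prod' fun j _ => hfac j) _)
  rw [Finset.prod_const, Finset.card_univ, Fintype.card_fin, ← ENNReal.ofReal_pow (by positivity),
    ← ENNReal.ofReal_mul (by positivity), ENNReal.ofReal_le_ofReal_iff (by positivity)] at h
  refine h.trans ?_
  rw [mul_pow C₁, ← mul_assoc]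
  gcongr
  exact le_max_right _ _

instance isProbabilityMeasure_torusHaar (D : ℕ) : IsProbabilityMeasure (torusHaar D) := by
  unfold torusHaar; infer_instance

instance isAddHaarMeasure_torusHaar (D : ℕ) : (torusHaar D).IsAddHaarMeasure := by
  unfold torusHaar; infer_instance

/-- Tonelli for a product of functions of separate coordinates. -/
theorem lintegral_pi_prod {ι : Type*} [Fintype ι] {X : ι → Type*} [∀ i, MeasurableSpace (X i)]
    (μ : ∀ i, Measure (X i)) [∀ i, IsProbabilityMeasure (μ i)] (g : ∀ i, X i → ENNReal)
    (hg : ∀ i, Measurable (g i)) :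
    ∫⁻ x, ∏ i, g i (x i) ∂Measure.pi μ = ∏ i, ∫⁻ x, g i x ∂μ i := by
  rw [ProbabilityTheory.lintegral_prod_eq_prod_lintegral_of_indepFun Finset.univ
    (fun i (x : ∀ i, X i) => g i (x i))
    (ProbabilityTheory.iIndepFun_pi fun i => (hg i).aemeasurable)
    fun i => (hg i).comp (measurable_pi_apply i)]
  exact Finset.prod_congr rfl fun i _ =>
    (measurePreserving_eval μ i).lintegral_comp (hg i)

/-- The mass of the heat kernel is bounded uniformly in time. -/
theorem exists_lintegral_heatKernel_le {D : ℕ} {Q : Matrix (Fin D) (Fin D) ℝ} (hQ : Q.PosDef) :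
    ∃ C : ℝ, 1 ≤ C ∧ ∀ α : ℝ, 0 < α →
      ∫⁻ θ, ENNReal.ofReal (heatKernel Q α θ) ∂torusHaar D ≤ ENNReal.ofReal C := by
  obtain ⟨c, hc, hcQ⟩ := hQ.exists_mul_sum_sq_le
  have hpi := Real.pi_pos
  set q := (2 * Real.pi) ^ D * Real.sqrt Q.det with hq
  refine ⟨max 1 (q * (1 / (2 * Real.pi * Real.sqrt c)) ^ D), le_max_left _ _, fun α hα => ?_⟩
  refine (lintegral_mono fun θ => heatKernel_le_prod_circleTheta Q hcQ hα θ).trans ?_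
  have hm := measurable_circleTheta (c / (4 * α))
  rw [lintegral_const_mul _ (Finset.measurable_fun_prod _ fun j _ => Measurable.const_mul
      (f := fun θ : Torus D => circleTheta (c / (4 * α)) (θ j))
      (hm.comp (measurable_pi_apply j)) _), torusHaar,
    lintegral_pi_prod _ (fun _ y => ENNReal.ofReal (1 / Real.sqrt (4 * Real.pi * α)) *
      circleTheta (c / (4 * α)) y) fun j => hm.const_mul _]
  rw [lintegral_const_mul _ hm, lintegral_circleTheta (by positivity), ← ENNReal.ofReal_mul
    (by positivity), Finset.prod_const, Finset.card_univ, Fintype.card_fin,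
    ← ENNReal.ofReal_pow (by positivity), ← ENNReal.ofReal_mul (by positivity)]
  refine ENNReal.ofReal_le_ofReal (le_trans (le_of_eq ?_) (le_max_right _ _))
  have e1 : Real.sqrt (Real.pi / (c / (4 * α))) = Real.sqrt (4 * Real.pi * α) / Real.sqrt c := by
    rw [← Real.sqrt_div (by positivity)]
    congr 1
    field_simp
  have : 0 < Real.sqrt (4 * Real.pi * α) := Real.sqrt_pos.2 (by positivity)
  rw [e1]
  congr 2
  field_simp

/-! ### Integer systems of equations on the torus -/

/-- Linearly independent integer rows have a rational right inverse; clearing denominators gives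
an integer matrix which is a right inverse up to a nonzero factor. -/
theorem exists_int_right_inverse {L R : Type*} [Fintype L] [Fintype R] [DecidableEq R]
    (ε : L → R → ℤ) (h : LinearIndependent ℚ fun (f : R) (e : L) => (ε e f : ℚ)) :
    ∃ (N : ℤ) (A : L → R → ℤ), N ≠ 0 ∧
      ∀ g f, ∑ e, ε e g * A e f = if g = f then N else 0 := by
  classical
  set v : R → L → ℚ := fun f e => (ε e f : ℚ) with hv
  obtain ⟨ψ, hψ⟩ := LinearMap.exists_leftInverse_of_injective (Fintype.linearCombination ℚ v)
    (LinearMap.ker_eq_bot.2 h.fintypeLinearCombination_injective)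
  have hψv : ∀ g, ψ (v g) = Pi.single g 1 := by
    intro g
    have := LinearMap.congr_fun hψ (Pi.single g 1)
    simpa [Fintype.linearCombination_apply_single] using this
  obtain ⟨b, hb⟩ := IsLocalization.exist_integer_multiples_of_finite (nonZeroDivisors ℤ)
    (fun p : L × R => ψ (Pi.single p.1 1) p.2)
  choose A hA using hb
  refine ⟨b, fun e f => A (e, f), nonZeroDivisors.ne_zero b.2, fun g f => ?_⟩
  have h1 : v g = ∑ e, (ε e g : ℚ) • (Pi.single e 1 : L → ℚ) := by
    ext e
    simp [hv, Finset.sum_apply, Pi.single_apply]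
  have h2 := congrFun (hψv g) f
  rw [h1, map_sum, Finset.sum_apply] at h2
  have h3 : ((∑ e, ε e g * A (e, f) : ℤ) : ℚ) = (b : ℤ) * (Pi.single g 1 : R → ℚ) f := by
    rw [← h2, Finset.mul_sum]
    push_cast
    refine Finset.sum_congr rfl fun e _ => ?_
    have := hA (e, f)
    simp only [algebraMap_int_eq, eq_intCast, zsmul_eq_mul] at this
    rw [this, map_smul, Pi.smul_apply, smul_eq_mul]
    ring
  rw [← Int.cast_inj (α := ℚ), h3]
  rcases eq_or_ne g f with rfl | hne
  · simp
  · simp [hne, hne.symm]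

/-- The torus is divisible. -/
theorem Torus.exists_zsmul_eq {D : ℕ} {N : ℤ} (hN : N ≠ 0) (y : Torus D) :
    ∃ z : Torus D, N • z = y := by
  have : ∀ j, ∃ z : AddCircle (2 * Real.pi), N • z = y j := by
    intro j
    obtain ⟨x, hx⟩ := QuotientAddGroup.mk_surjective (y j)
    refine ⟨((x / N : ℝ) : AddCircle (2 * Real.pi)), ?_⟩
    rw [← AddCircle.coe_zsmul, zsmul_eq_mul, mul_div_cancel₀ _ (by exact_mod_cast hN)]
    exact hx
  choose z hz using this
  exact ⟨z, funext hz⟩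

/-- The tuple of integer combinations `∑ e, ε e f • h e` of torus variables, as a homomorphism. -/
def holonomyHom (D : ℕ) {L R : Type*} [Fintype L] (ε : L → R → ℤ) :
    (L → Torus D) →+ (R → Torus D) where
  toFun h f := ∑ e, ε e f • h e
  map_zero' := by ext; simp
  map_add' a b := by ext; simp [Finset.sum_add_distrib]

theorem continuous_zsmul_sum (D : ℕ) {L : Type*} [Fintype L] (n : L → ℤ) :
    Continuous fun h : L → Torus D => ∑ e, n e • h e :=
  continuous_finsetSum _ fun e _ => (continuous_apply e).zsmul _

theorem holonomyHom_surjective (D : ℕ) {L R : Type*} [Fintype L] [Fintype R] (ε : L → R → ℤ)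
    (h : LinearIndependent ℚ fun (f : R) (e : L) => (ε e f : ℚ)) :
    Function.Surjective (holonomyHom D ε) := by
  classical
  obtain ⟨N, A, hN, hA⟩ := exists_int_right_inverse ε h
  intro y
  choose z hz using fun f => Torus.exists_zsmul_eq hN (y f)
  refine ⟨fun e => ∑ f, A e f • z f, funext fun g => ?_⟩
  change ∑ e, ε e g • ∑ f, A e f • z f = y g
  simp_rw [Finset.smul_sum, smul_smul]
  rw [Finset.sum_comm]
  simp_rw [← Finset.sum_smul, hA, ite_smul, zero_smul]
  simp [hz]

/-- A surjective homomorphism of tori pushes Haar measure forward to Haar measure. -/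
theorem measurePreserving_holonomyHom (D : ℕ) {L R : Type*} [Fintype L] [Fintype R]
    (ε : L → R → ℤ) (h : LinearIndependent ℚ fun (f : R) (e : L) => (ε e f : ℚ)) :
    MeasurePreserving (holonomyHom D ε) (Measure.pi fun _ : L => torusHaar D)
      (Measure.pi fun _ : R => torusHaar D) := by
  have b1 : BorelSpace (L → Torus D) := Pi.borelSpace (X := fun _ : L => Torus D)
  have b2 : BorelSpace (R → Torus D) := Pi.borelSpace (X := fun _ : R => Torus D)
  have i1 : (Measure.pi fun _ : L => torusHaar D).IsAddHaarMeasure :=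
    Measure.pi.isAddHaarMeasure _
  have i2 : (Measure.pi fun _ : R => torusHaar D).IsAddHaarMeasure :=
    Measure.pi.isAddHaarMeasure _
  refine AddMonoidHom.measurePreserving ?_ (holonomyHom_surjective D ε h)
    (by rw [measure_univ, measure_univ])
  exact continuous_pi fun f => continuous_zsmul_sum D fun e => ε e f

/-! ### Bases adapted to a filtration -/

/-- Greedy choice of a basis, from the top of the filtration by `s` downwards: the basis vectors of
height at least `i` span all vectors of height at least `i`, simultaneously for all `i`. -/
theorem exists_linearIndepOn_span_filtration {ι K V : Type*} [DivisionRing K] [AddCommGroup V]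
    [Module K V] (v : ι → V) (s : ι → ℕ) (n : ℕ) (hn : ∀ f, s f ≤ n) :
    ∃ R : Set ι, LinearIndepOn K v R ∧
      ∀ i f, i ≤ s f → v f ∈ Submodule.span K (v '' {g | g ∈ R ∧ i ≤ s g}) := by
  suffices H : ∀ j ≤ n + 1, ∃ R : Set ι, R ⊆ {f | n + 1 - j ≤ s f} ∧ LinearIndepOn K v R ∧
      ∀ i, n + 1 - j ≤ i → ∀ f, i ≤ s f →
        v f ∈ Submodule.span K (v '' {g | g ∈ R ∧ i ≤ s g}) by
    obtain ⟨R, -, h1, h2⟩ := H (n + 1) le_rfl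
    exact ⟨R, h1, fun i f hf => h2 i (by omega) f hf⟩
  intro j
  induction j with
  | zero =>
    intro _
    refine ⟨∅, by simp, linearIndepOn_empty K v, fun i hi f hf => ?_⟩
    have := hn f
    omega
  | succ j ih =>
    intro hj
    obtain ⟨R, hR, hind, hspan⟩ := ih (by omega)
    obtain ⟨R', h1, h2, h3, h4⟩ := exists_linearIndepOn_extension hind
      (t := {f | n + 1 - (j + 1) ≤ s f}) fun f hf => by
        have h : n + 1 - j ≤ s f := hR hf
        change n + 1 - (j + 1) ≤ s f
        omega
    refine ⟨R', h1, h4, fun i hi f hf => ?_⟩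
    by_cases hij : n + 1 - j ≤ i
    · exact Submodule.span_mono (Set.image_mono (fun g hg => ⟨h2 hg.1, hg.2⟩ :
        {g | g ∈ R ∧ i ≤ s g} ⊆ {g | g ∈ R' ∧ i ≤ s g})) (hspan i hij f hf)
    · have hi' : i = n + 1 - (j + 1) := by omega
      subst hi'
      have h5 := h3 ⟨f, hf, rfl⟩
      exact Submodule.span_mono (Set.image_mono (fun g hg => ⟨hg, h1 hg⟩ :
        R' ⊆ {g | g ∈ R' ∧ n + 1 - (j + 1) ≤ s g})) h5

/-! ### Connected components and ranks -/

namespace TensorGraph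

variable {d : ℕ} {G : TensorGraph d}

theorem Face.exists_through (f : G.Face) : ∃ e, f.Through e := by
  obtain ⟨e, he⟩ := Quot.exists_rep f.2
  exact ⟨e, he⟩

/-- The face `f` passes only through lines of `H`. -/
def Face.Within (f : G.Face) (H : Finset G.Line) : Prop := ∀ e, f.Through e → e ∈ H

theorem mem_components {H C : Finset G.Line} :
    C ∈ components H ↔
      ∃ e ∈ H, ∀ e', e' ∈ C ↔ e' ∈ H ∧ Relation.ReflTransGen (ShareFace H) e e' := by
  classical
  simp only [components, Finset.mem_image]
  refine exists_congr fun e => and_congr_right fun _ => ?_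
  rw [eq_comm, Finset.ext_iff]
  simp only [Finset.mem_filter]

theorem subset_of_mem_components {H C : Finset G.Line} (hC : C ∈ components H) : C ⊆ H := by
  obtain ⟨e, -, h⟩ := mem_components.1 hC
  exact fun e' he' => ((h e').1 he').1

theorem shareFace_symm {H : Finset G.Line} {e e' : G.Line} (h : ShareFace H e e') :
    ShareFace H e' e :=
  h.imp fun _ hf => hf.symm

theorem reflTransGen_shareFace_symm {H : Finset G.Line} {e e' : G.Line}
    (h : Relation.ReflTransGen (ShareFace H) e e') : Relation.ReflTransGen (ShareFace H) e' e := by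
  induction h with
  | refl => exact .refl
  | tail _ h ih => exact .head (shareFace_symm h) ih

theorem pairwiseDisjoint_components (H : Finset G.Line) :
    (components H : Set (Finset G.Line)).PairwiseDisjoint id := by
  classical
  intro C hC C' hC' hne
  obtain ⟨e₁, -, h₁⟩ := mem_components.1 (Finset.mem_coe.1 hC)
  obtain ⟨e₂, -, h₂⟩ := mem_components.1 (Finset.mem_coe.1 hC')
  refine Finset.disjoint_left.2 fun e he he' => hne ?_
  have h := ((h₁ e).1 he).2.trans (reflTransGen_shareFace_symm ((h₂ e).1 he').2)
  ext x
  rw [h₁, h₂]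
  exact and_congr_right fun _ =>
    ⟨fun hx => (reflTransGen_shareFace_symm h).trans hx, fun hx => h.trans hx⟩

/-- A closed face of `H` that meets a component of `H` stays inside it. -/
theorem Face.within_of_mem_components {H C : Finset G.Line} (hC : C ∈ components H) {f : G.Face}
    (hf : f.IsClosed) (hfH : f.Within H) {e : G.Line} (he : f.Through e) (heC : e ∈ C) :
    f.Within C := by
  obtain ⟨e₀, -, h⟩ := mem_components.1 hC
  intro e' he'
  exact (h e').2 ⟨hfH e' he', ((h e).1 heC).2.tail ⟨⟨f, hf, hfH⟩, he, he'⟩⟩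

theorem Face.exists_component_within {H : Finset G.Line} {f : G.Face} (hf : f.IsClosed)
    (hfH : f.Within H) : ∃ C ∈ components H, f.Within C := by
  classical
  obtain ⟨e, he⟩ := f.exists_through
  have hC : (H.filter fun e' => Relation.ReflTransGen (ShareFace H) e e') ∈ components H :=
    mem_components.2 ⟨e, hfH e he, fun e' => by simp⟩
  exact ⟨_, hC, Face.within_of_mem_components hC hf hfH he
    (by simp [hfH e he, Relation.ReflTransGen.refl])⟩

/-- The row of the incidence matrix that belongs to a closed face. -/
def Orientation.row (o : G.Orientation) (f : G.ClosedFace) : G.Line → ℚ :=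
  fun e => o.incidence e f.1

theorem Orientation.incidence_eq_zero (o : G.Orientation) {e : G.Line} {f : G.Face}
    (h : ¬ f.Through e) : o.incidence e f = 0 := by
  simp [Orientation.incidence, h]

open scoped Classical in
/-- If the closed faces in `R` and in `H` span all closed faces of `H`, then each component `C` of
`H` contains at least `r(C)` of them: restricted to the lines of `C`, all faces of `H` that are not
in `C` vanish. -/
theorem Orientation.rank_component_le (o : G.Orientation) {H C : Finset G.Line}
    (hC : C ∈ components H) (R : Set G.ClosedFace)
    (hR : ∀ f : G.ClosedFace, f.1.Within H →
      o.row f ∈ Submodule.span ℚ (o.row '' {g | g ∈ R ∧ g.1.Within H})) :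
    o.rank C ≤ (Finset.univ.filter fun g : G.ClosedFace => g ∈ R ∧ g.1.Within C).card := by
  rw [Orientation.rank, Matrix.rank_eq_finrank_span_cols]
  set S := Finset.univ.filter fun g : G.ClosedFace => g ∈ R ∧ g.1.Within C with hS
  let π : (G.Line → ℚ) →ₗ[ℚ] (C → ℚ) := LinearMap.funLeft ℚ ℚ Subtype.val
  have hle : Submodule.span ℚ (Set.range (Matrix.of fun (e : C) (f : InternalFace C) =>
      (o.incidence e.1 f.1 : ℚ)).col) ≤
        Submodule.span ℚ ((S.image fun g => π (o.row g) : Finset (C → ℚ)) : Set (C → ℚ)) := by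
    rw [Submodule.span_le]
    rintro _ ⟨f, rfl⟩
    have hfH : f.1.Within H := fun e he => subset_of_mem_components hC (f.2.2 e he)
    have h1 : π (o.row ⟨f.1, f.2.1⟩) ∈ Submodule.map π _ :=
      Submodule.mem_map_of_mem (hR ⟨f.1, f.2.1⟩ hfH)
    rw [Submodule.map_span] at h1
    refine Submodule.span_le.2 ?_ h1
    rintro _ ⟨_, ⟨g, ⟨hgR, hgH⟩, rfl⟩, rfl⟩
    by_cases hgC : g.1.Within C
    · exact Submodule.subset_span (by
        simp only [Finset.coe_image, Set.mem_image, Finset.mem_coe]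
        exact ⟨g, by simp [hS, hgR, hgC], rfl⟩)
    · have h0 : π (o.row g) = 0 := by
        ext e
        have : ¬ g.1.Through e.1 := fun he =>
          hgC (Face.within_of_mem_components hC g.2 hgH he e.2)
        simp [π, LinearMap.funLeft, Orientation.row, o.incidence_eq_zero this]
      rw [h0]
      exact Submodule.zero_mem _
  refine (Submodule.finrank_mono hle).trans ?_
  exact (finrank_span_finset_le_card _).trans Finset.card_image_le

open scoped Classical in
theorem card_internalFace (H : Finset G.Line) :
    Fintype.card (InternalFace H) =
      (Finset.univ.filter fun g : G.ClosedFace => g.1.Within H).card := by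
  rw [← Fintype.card_subtype]
  exact Fintype.card_congr (Equiv.subtypeSubtypeEquivSubtypeInter _ _).symm

open scoped Classical in
/-- Lower bound on the total divergence degree of the components of `H`. -/
theorem Orientation.le_sum_divergenceDegree (o : G.Orientation) (D : ℕ) (H : Finset G.Line)
    (R : Set G.ClosedFace)
    (hR : ∀ f : G.ClosedFace, f.1.Within H →
      o.row f ∈ Submodule.span ℚ (o.row '' {g | g ∈ R ∧ g.1.Within H})) :
    -2 * (H.card : ℤ) + D * ((Finset.univ.filter
        fun g : G.ClosedFace => g ∉ R ∧ g.1.Within H).card : ℤ) ≤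
      ∑ C ∈ components H, o.divergenceDegree D C := by
  have h1 : ∑ C ∈ components H, C.card ≤ H.card := by
    rw [show ∑ C ∈ components H, C.card = ((components H).biUnion id).card from
      (Finset.card_biUnion (t := id) (pairwiseDisjoint_components H)).symm]
    exact Finset.card_le_card (Finset.biUnion_subset.2 fun C hC => subset_of_mem_components hC)
  have h2 : (Finset.univ.filter fun g : G.ClosedFace => g ∉ R ∧ g.1.Within H).card ≤
      ∑ C ∈ components H,
        (Finset.univ.filter fun g : G.ClosedFace => g ∉ R ∧ g.1.Within C).card := by
    refine le_trans (Finset.card_le_card fun g hg => ?_) Finset.card_biUnion_le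
    obtain ⟨-, hgR, hgH⟩ := Finset.mem_filter.1 hg
    obtain ⟨C, hC, hgC⟩ := Face.exists_component_within g.2 hgH
    exact Finset.mem_biUnion.2 ⟨C, hC, by simp [hgR, hgC]⟩
  have h3 : ∀ C ∈ components H, -2 * (C.card : ℤ) + D * ((Finset.univ.filter
      fun g : G.ClosedFace => g ∉ R ∧ g.1.Within C).card : ℤ) ≤ o.divergenceDegree D C := by
    intro C hC
    have h4 := o.rank_component_le hC R hR
    have h5 : (Finset.univ.filter fun g : G.ClosedFace => g ∈ R ∧ g.1.Within C).card +
        (Finset.univ.filter fun g : G.ClosedFace => g ∉ R ∧ g.1.Within C).card =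
          Fintype.card (InternalFace C) := by
      rw [card_internalFace, ← Finset.card_filter_add_card_filter_not
        (s := Finset.univ.filter fun g : G.ClosedFace => g.1.Within C) (fun g => g ∈ R),
        Finset.filter_filter, Finset.filter_filter]
      simp only [and_comm]
    rw [Orientation.divergenceDegree]
    gcongr
    omega
  refine le_trans ?_ (Finset.sum_le_sum h3)
  rw [Finset.sum_add_distrib, ← Finset.mul_sum, ← Finset.mul_sum]
  have h1' : (∑ C ∈ components H, (C.card : ℤ)) ≤ H.card := by exact_mod_cast h1
  have h2' := Nat.cast_le (α := ℤ).2 h2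
  rw [Nat.cast_sum] at h2'
  have h2'' := mul_le_mul_of_nonneg_left h2' (Nat.cast_nonneg (α := ℤ) D)
  linarith

/-! ### Scales of faces -/

open scoped Classical in
/-- The scale of a face: the smallest scale of its lines. -/
def Face.scale (μ : G.Line → ℕ) (f : G.Face) : ℕ :=
  (Finset.univ.filter f.Through).inf'
    (by obtain ⟨e, he⟩ := f.exists_through; exact ⟨e, by simp [he]⟩) μ

theorem Face.le_scale_iff {μ : G.Line → ℕ} {f : G.Face} {i : ℕ} :
    i ≤ f.scale μ ↔ f.Within (highPart μ i) := by
  classical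
  simp [Face.scale, Finset.le_inf'_iff, Face.Within, highPart]

theorem Face.exists_through_scale_eq (μ : G.Line → ℕ) (f : G.Face) :
    ∃ e, f.Through e ∧ μ e = f.scale μ := by
  classical
  obtain ⟨e, he, h⟩ := Finset.exists_mem_eq_inf' (s := Finset.univ.filter f.Through)
    (by obtain ⟨e, he⟩ := f.exists_through; exact ⟨e, by simp [he]⟩) μ
  exact ⟨e, by simpa using he, h.symm⟩

theorem Face.scale_le {μ : G.Line → ℕ} {ρ : ℕ} (hμ : ∀ e, μ e ≤ ρ) (f : G.Face) :
    f.scale μ ≤ ρ := by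
  obtain ⟨e, -, he⟩ := f.exists_through_scale_eq μ
  exact he ▸ hμ e

/-- Summing over all thresholds the number of elements whose height passes the threshold. -/
theorem sum_range_card_filter {ι : Type*} (S : Finset ι) (s : ι → ℕ) {ρ : ℕ}
    (hs : ∀ x ∈ S, s x ≤ ρ) :
    ∑ i ∈ Finset.range (ρ + 1), (S.filter fun x => i ≤ s x).card = ∑ x ∈ S, (s x + 1) := by
  simp_rw [Finset.card_filter]
  rw [Finset.sum_comm]
  refine Finset.sum_congr rfl fun x hx => ?_
  have := hs x hx
  rw [← Finset.card_filter, ← Finset.card_range (s x + 1)]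
  congr 1
  ext i
  simp only [Finset.mem_filter, Finset.mem_range]
  omega

theorem zpow_sum₀ {ι : Type*} {a : ℝ} (ha : a ≠ 0) (S : Finset ι) (f : ι → ℤ) :
    a ^ (∑ i ∈ S, f i) = ∏ i ∈ S, a ^ f i := by
  classical
  induction S using Finset.induction_on with
  | empty => simp
  | insert i S hi ih => rw [Finset.sum_insert hi, Finset.prod_insert hi, zpow_add₀ ha, ih]

open scoped Classical in
/-- Power counting: a linearly independent set `R` of closed faces such that the decay of the lines
and the divergence of the closed faces outside `R` multiply up to the product of the powers
`M ^ ω` over the Gallavotti-Nicolò tree. -/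
theorem Orientation.exists_linearIndepOn_power_counting (o : G.Orientation) (D : ℕ) {M : ℝ}
    (hM : 1 < M) {ρ : ℕ} {μ : G.Line → ℕ} (hμ : ∀ e, μ e ≤ ρ) :
    ∃ R : Finset G.ClosedFace, LinearIndependent ℚ (fun f : R => o.row f.1) ∧
      (∏ e, (M ^ (2 * μ e))⁻¹) * ∏ f ∈ Rᶜ, (M ^ f.1.scale μ) ^ D ≤
        (M ^ 2) ^ Fintype.card G.Line *
          ∏ i ∈ Finset.range (ρ + 1), ∏ C ∈ components (highPart μ i),
            M ^ o.divergenceDegree D C := by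
  have hM0 : M ≠ 0 := by positivity
  obtain ⟨R, hind, hspan⟩ := exists_linearIndepOn_span_filtration (K := ℚ) o.row
    (fun f => f.1.scale μ) ρ fun f => f.1.scale_le hμ
  refine ⟨R.toFinset, ?_, ?_⟩
  · have : LinearIndependent ℚ fun f : R => o.row f.1 := hind
    exact this.comp (fun f : R.toFinset => ⟨f.1, Set.mem_toFinset.1 f.2⟩)
      fun f g hfg => Subtype.ext (congrArg (fun x : R => x.1) hfg)
  have h1 : ∀ i ∈ Finset.range (ρ + 1),
      -2 * ((highPart μ i).card : ℤ) + D * ((Finset.univ.filter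
        fun g : G.ClosedFace => g ∉ R ∧ g.1.Within (highPart μ i)).card : ℤ) ≤
      ∑ C ∈ components (highPart μ i), o.divergenceDegree D C := by
    intro i _
    refine o.le_sum_divergenceDegree D _ R fun f hf => ?_
    have := hspan i f (Face.le_scale_iff.2 hf)
    simpa only [Face.le_scale_iff] using this
  have h2 := Finset.sum_le_sum h1
  rw [Finset.sum_add_distrib, ← Finset.mul_sum, ← Finset.mul_sum] at h2
  have h3 : ∑ i ∈ Finset.range (ρ + 1), (highPart μ i).card = ∑ e, (μ e + 1) :=
    sum_range_card_filter Finset.univ μ fun e _ => hμ e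
  have h4 : ∑ i ∈ Finset.range (ρ + 1), (Finset.univ.filter
        fun g : G.ClosedFace => g ∉ R ∧ g.1.Within (highPart μ i)).card =
      ∑ f ∈ R.toFinsetᶜ, (f.1.scale μ + 1) := by
    rw [← sum_range_card_filter R.toFinsetᶜ (fun f => f.1.scale μ)
      fun f _ => f.1.scale_le hμ]
    refine Finset.sum_congr rfl fun i _ => congrArg Finset.card ?_
    ext f
    simp [Face.le_scale_iff]
  have h3' : ∑ i ∈ Finset.range (ρ + 1), ((highPart μ i).card : ℤ) = ∑ e, ((μ e : ℤ) + 1) := by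
    exact_mod_cast h3
  have h4' : ∑ i ∈ Finset.range (ρ + 1), ((Finset.univ.filter
        fun g : G.ClosedFace => g ∉ R ∧ g.1.Within (highPart μ i)).card : ℤ) =
      ∑ f ∈ R.toFinsetᶜ, ((f.1.scale μ : ℤ) + 1) := by
    exact_mod_cast h4
  rw [h3', h4', Finset.sum_add_distrib, Finset.sum_add_distrib] at h2
  have hL : (∏ e, (M ^ (2 * μ e))⁻¹) = M ^ (-2 * ∑ e, (μ e : ℤ)) := by
    rw [Finset.mul_sum, zpow_sum₀ hM0]
    refine Finset.prod_congr rfl fun e _ => ?_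
    rw [← zpow_natCast, ← zpow_neg]
    refine congrArg (M ^ ·) ?_
    push_cast
    ring
  have hF : ∏ f ∈ R.toFinsetᶜ, (M ^ f.1.scale μ) ^ D =
      M ^ ((D : ℤ) * ∑ f ∈ R.toFinsetᶜ, (f.1.scale μ : ℤ)) := by
    rw [Finset.mul_sum, zpow_sum₀ hM0]
    refine Finset.prod_congr rfl fun f _ => ?_
    rw [← pow_mul, ← zpow_natCast]
    congr 1
    push_cast
    ring
  have hR : ∏ i ∈ Finset.range (ρ + 1), ∏ C ∈ components (highPart μ i),
        M ^ o.divergenceDegree D C =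
      M ^ ∑ i ∈ Finset.range (ρ + 1), ∑ C ∈ components (highPart μ i),
        o.divergenceDegree D C := by
    simp_rw [zpow_sum₀ hM0]
  have hc : (M ^ 2) ^ Fintype.card G.Line = M ^ (2 * (Fintype.card G.Line : ℤ)) := by
    rw [← pow_mul, ← zpow_natCast]
    push_cast
    rfl
  rw [hL, hF, hR, hc, ← zpow_add₀ hM0, ← zpow_add₀ hM0]
  refine zpow_le_zpow_right₀ hM.le ?_
  -- a face of scale `s` is internal to the `s + 1` subgraphs `G_0, ..., G_s`; the surplus of one
  -- only helps for faces and costs the factor `M ^ 2` for each line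
  have h5 : 0 ≤ (D : ℤ) * ∑ f ∈ R.toFinsetᶜ, (1 : ℤ) := by positivity
  simp only [Finset.sum_const, Finset.card_univ, nsmul_eq_mul, mul_one] at h2 h5
  linarith

end TensorGraph

/-! ### Schwinger slices -/

theorem inv_sq_le_of_mem_schwingerSlice {M : ℝ} {i : ℕ} {a : ℝ}
    (ha : a ∈ schwingerSlice M i) : ((M ^ i) ^ 2)⁻¹ ≤ a := by
  cases i with
  | zero => simpa [schwingerSlice] using ha
  | succ i =>
    rw [← pow_mul, mul_comm]
    exact ha.1

theorem measurableSet_schwingerSlice (M : ℝ) (i : ℕ) : MeasurableSet (schwingerSlice M i) := by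
  cases i with
  | zero => exact measurableSet_Ici
  | succ i => exact measurableSet_Icc

theorem integrableOn_exp_schwingerSlice {m M : ℝ} (hm : 0 < m) (i : ℕ) :
    IntegrableOn (fun a => Real.exp (-(m ^ 2 * a))) (schwingerSlice M i) := by
  cases i with
  | zero =>
    have h := exp_neg_integrableOn_Ioi 1 (b := m ^ 2) (by positivity)
    simp only [neg_mul] at h
    exact (integrableOn_Ici_iff_integrableOn_Ioi).2 h
  | succ i => exact Continuous.integrableOn_Icc (by fun_prop)

/-- The slice of scale `i` contributes its length, of order `M ^ (-2 i)`; in the infinite slice of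
scale zero the mass makes the integral finite. -/
theorem exists_integral_exp_schwingerSlice_le {m M : ℝ} (hm : 0 < m) (hM : 1 < M) :
    ∃ C : ℝ, 0 < C ∧ ∀ i, ∫ a in schwingerSlice M i, Real.exp (-(m ^ 2 * a)) ≤
      C * (M ^ (2 * i))⁻¹ := by
  refine ⟨max (∫ a in schwingerSlice M 0, Real.exp (-(m ^ 2 * a))) (M ^ 2),
    lt_max_of_lt_right (by positivity), fun i => ?_⟩
  cases i with
  | zero => simp
  | succ i =>
    have hM0 : 0 < M := by linarith
    have hle : (M ^ (2 * (i + 1)))⁻¹ ≤ (M ^ (2 * i))⁻¹ := by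
      gcongr
      · exact hM.le
      · omega
    have hvol : volume.real (schwingerSlice M (i + 1)) ≤ (M ^ (2 * i))⁻¹ := by
      rw [schwingerSlice, Real.volume_real_Icc_of_le hle]
      have : 0 < (M ^ (2 * (i + 1)))⁻¹ := by positivity
      linarith
    have hfin : volume (schwingerSlice M (i + 1)) < ⊤ := measure_Icc_lt_top
    have h1 := norm_setIntegral_le_of_norm_le_const (μ := volume) (C := 1)
      (f := fun a => Real.exp (-(m ^ 2 * a))) hfin fun a ha => by
        have : 0 ≤ a := le_trans (by positivity) ha.1
        rw [Real.norm_eq_abs, abs_of_pos (Real.exp_pos _), Real.exp_le_one_iff]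
        have : 0 ≤ m ^ 2 * a := by positivity
        linarith
    refine ((le_abs_self _).trans h1).trans ?_
    rw [one_mul]
    refine hvol.trans (le_trans (le_of_eq ?_)
      (mul_le_mul_of_nonneg_right (le_max_right _ (M ^ 2)) (by positivity)))
    rw [mul_add, pow_add]
    field_simp

/-! ### The integrand of the amplitude -/

instance isNegInvariant_torusHaar (D : ℕ) : (torusHaar D).IsNegInvariant :=
  ⟨(AddMonoidHom.measurePreserving (f := (negAddMonoidHom : Torus D →+ Torus D))
    continuous_neg neg_surjective rfl).map_eq⟩

namespace TensorGraph

variable {d : ℕ} {G : TensorGraph d} {D : ℕ}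

theorem card_face_le (G : TensorGraph d) : Fintype.card G.Face ≤ d * Fintype.card G.Line := by
  let F : Fin d × G.Line → G.Face := fun p => ⟨p.1, Quot.mk _ p.2⟩
  have hF : Function.Surjective F := by
    rintro ⟨ℓ, q⟩
    obtain ⟨e, rfl⟩ := Quot.exists_rep q
    exact ⟨(ℓ, e), rfl⟩
  refine (Fintype.card_le_of_surjective F hF).trans ?_
  rw [Fintype.card_prod, Fintype.card_fin]

/-- The line of lowest scale already makes `α(f)` as large as its slice requires. -/
theorem Face.inv_sq_le_alpha {M : ℝ} {μ : G.Line → ℕ} {α : G.Line → ℝ}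
    (hα : ∀ e, α e ∈ schwingerSlice M (μ e)) (f : G.Face) :
    ((M ^ f.scale μ) ^ 2)⁻¹ ≤ f.alpha α := by
  classical
  obtain ⟨e, he, hs⟩ := f.exists_through_scale_eq μ
  rw [← hs]
  refine (inv_sq_le_of_mem_schwingerSlice (hα e)).trans ?_
  refine Finset.single_le_sum (f := α) (fun e' _ => ?_) (by simpa using he)
  exact le_trans (by positivity) (inv_sq_le_of_mem_schwingerSlice (hα e'))

theorem Face.alpha_pos {M : ℝ} (hM : 1 < M) {μ : G.Line → ℕ} {α : G.Line → ℝ}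
    (hα : ∀ e, α e ∈ schwingerSlice M (μ e)) (f : G.Face) : 0 < f.alpha α :=
  lt_of_lt_of_le (by positivity) (f.inv_sq_le_alpha hα)

theorem Face.measurable_alpha (f : G.Face) : Measurable f.alpha := by
  unfold Face.alpha
  fun_prop

theorem Orientation.measurable_holonomy (o : G.Orientation) (f : G.Face) :
    Measurable (o.holonomy (D := D) f) := by
  have b1 : BorelSpace (G.Line → Torus D) := Pi.borelSpace (X := fun _ : G.Line => Torus D)
  exact (continuous_zsmul_sum D fun e => o.incidence e f).measurable

theorem Orientation.integrand_nonneg (o : G.Orientation) (Q : Matrix (Fin D) (Fin D) ℝ) (m : ℝ)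
    (gs gt : G.OpenFace → Torus D) (p : (G.Line → ℝ) × (G.Line → Torus D)) :
    0 ≤ o.integrand Q m gs gt p :=
  mul_nonneg (mul_nonneg (Finset.prod_nonneg fun _ _ => (Real.exp_pos _).le)
    (Finset.prod_nonneg fun _ _ => heatKernel_nonneg _ _ _))
    (Finset.prod_nonneg fun _ _ => heatKernel_nonneg _ _ _)

theorem Orientation.measurable_integrand (o : G.Orientation) (Q : Matrix (Fin D) (Fin D) ℝ) (m : ℝ)
    (gs : G.OpenFace → Torus D) :
    Measurable fun q : (G.OpenFace → Torus D) × ((G.Line → ℝ) × (G.Line → Torus D)) =>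
      o.integrand Q m gs q.1 q.2 := by
  unfold Orientation.integrand
  have hK := measurable_heatKernel Q
  refine Measurable.mul (Measurable.mul ?_ ?_) ?_
  · exact Finset.measurable_fun_prod _ fun e _ => by fun_prop
  · refine Finset.measurable_fun_prod _ fun f _ => hK.comp (Measurable.prodMk ?_ ?_)
    · exact f.1.measurable_alpha.comp (by fun_prop)
    · exact (o.measurable_holonomy f.1).comp (by fun_prop)
  · refine Finset.measurable_fun_prod _ fun f _ => hK.comp (Measurable.prodMk ?_ ?_)
    · exact f.1.measurable_alpha.comp (by fun_prop)
    · have h1 : Measurable fun q : (G.OpenFace → Torus D) × ((G.Line → ℝ) × (G.Line → Torus D)) =>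
          o.holonomy f.1 q.2.2 := (o.measurable_holonomy f.1).comp (by fun_prop)
      have h2 : Measurable fun q : (G.OpenFace → Torus D) × ((G.Line → ℝ) × (G.Line → Torus D)) =>
          q.1 f := (measurable_pi_apply f).comp measurable_fst
      exact (h1.const_add (gs f)).sub h2

theorem ae_mem_schwingerSlice (G : TensorGraph d) (M : ℝ) (μ : G.Line → ℕ) :
    ∀ᵐ α ∂(Measure.pi fun e => volume.restrict (schwingerSlice M (μ e))),
      ∀ e, α e ∈ schwingerSlice M (μ e) :=
  ae_all_iff.2 fun e => (Measure.quasiMeasurePreserving_eval _ e).ae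
    (ae_restrict_mem (measurableSet_schwingerSlice M (μ e)))

theorem integrable_prod_exp (G : TensorGraph d) {m : ℝ} (hm : 0 < m) (M : ℝ) (μ : G.Line → ℕ) :
    Integrable (fun α : G.Line → ℝ => ∏ e, Real.exp (-(m ^ 2 * α e)))
      (Measure.pi fun e => volume.restrict (schwingerSlice M (μ e))) :=
  Integrable.fintype_prod_dep fun e => integrableOn_exp_schwingerSlice hm (μ e)

instance sigmaFinite_lineMeasure (G : TensorGraph d) (D : ℕ) (M : ℝ) (μ : G.Line → ℕ) :
    SigmaFinite (lineMeasure G D M μ) := by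
  unfold lineMeasure; infer_instance

/-- On the slices all heat kernels are bounded, so that the integrand is dominated by a multiple of
the mass factors, uniformly in the boundary variables. -/
theorem Orientation.exists_integrand_le (o : G.Orientation) {Q : Matrix (Fin D) (Fin D) ℝ}
    (hQ : Q.PosDef) (m : ℝ) {M : ℝ} (hM : 1 < M) (μ : G.Line → ℕ) :
    ∃ B : ℝ, ∀ gs gt : G.OpenFace → Torus D, ∀ p : (G.Line → ℝ) × (G.Line → Torus D),
      (∀ e, p.1 e ∈ schwingerSlice M (μ e)) →
        ‖o.integrand Q m gs gt p‖ ≤ B * ∏ e, Real.exp (-(m ^ 2 * p.1 e)) := by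
  obtain ⟨C, hC, hK⟩ := exists_heatKernel_le hQ
  refine ⟨(∏ f : G.ClosedFace, C * (M ^ f.1.scale μ) ^ D) *
    ∏ f : G.OpenFace, C * (M ^ f.1.scale μ) ^ D, fun gs gt p hp => ?_⟩
  have hface : ∀ (f : G.Face) θ, heatKernel Q (f.alpha p.1) θ ≤ C * (M ^ f.scale μ) ^ D :=
    fun f θ => hK _ _ (one_le_pow₀ hM.le) (f.inv_sq_le_alpha hp) θ
  rw [Real.norm_eq_abs, abs_of_nonneg (o.integrand_nonneg Q m gs gt p), mul_comm,
    Orientation.integrand, mul_assoc]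
  refine mul_le_mul_of_nonneg_left (mul_le_mul ?_ ?_ ?_ ?_)
    (Finset.prod_nonneg fun _ _ => (Real.exp_pos _).le)
  · exact Finset.prod_le_prod (fun _ _ => heatKernel_nonneg _ _ _) fun f _ => hface _ _
  · exact Finset.prod_le_prod (fun _ _ => heatKernel_nonneg _ _ _) fun f _ => hface _ _
  · exact Finset.prod_nonneg fun _ _ => heatKernel_nonneg _ _ _
  · exact Finset.prod_nonneg fun _ _ => by positivity

theorem Orientation.integrable_integrand (o : G.Orientation) {Q : Matrix (Fin D) (Fin D) ℝ}
    (hQ : Q.PosDef) {m M : ℝ} (hm : 0 < m) (hM : 1 < M) (μ : G.Line → ℕ)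
    (gs gt : G.OpenFace → Torus D) :
    Integrable (o.integrand Q m gs gt) (lineMeasure G D M μ) := by
  obtain ⟨B, hB⟩ := o.exists_integrand_le hQ m hM μ
  refine Integrable.mono' (((integrable_prod_exp G hm M μ).comp_fst _).const_mul B)
    ((o.measurable_integrand Q m gs).comp measurable_prodMk_left).aestronglyMeasurable ?_
  filter_upwards [Measure.quasiMeasurePreserving_fst.ae (ae_mem_schwingerSlice G M μ)] with p hp
  exact hB gs gt p hp

theorem Orientation.integrable_integrand_prod (o : G.Orientation) {Q : Matrix (Fin D) (Fin D) ℝ}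
    (hQ : Q.PosDef) {m M : ℝ} (hm : 0 < m) (hM : 1 < M) (μ : G.Line → ℕ)
    (gs : G.OpenFace → Torus D) :
    Integrable (fun q : (G.OpenFace → Torus D) × ((G.Line → ℝ) × (G.Line → Torus D)) =>
      o.integrand Q m gs q.1 q.2)
      ((Measure.pi fun _ => torusHaar D).prod (lineMeasure G D M μ)) := by
  obtain ⟨B, hB⟩ := o.exists_integrand_le hQ m hM μ
  refine Integrable.mono' ((((integrable_prod_exp G hm M μ).comp_fst
    (Measure.pi fun _ : G.Line => torusHaar D)).comp_snd
      (Measure.pi fun _ : G.OpenFace => torusHaar D)).const_mul B)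
    (o.measurable_integrand Q m gs).aestronglyMeasurable ?_
  have h : ∀ᵐ p ∂lineMeasure G D M μ, ∀ e, p.1 e ∈ schwingerSlice M (μ e) :=
    Measure.quasiMeasurePreserving_fst.ae (ae_mem_schwingerSlice G M μ)
  filter_upwards [Measure.quasiMeasurePreserving_snd.ae h] with q hq
  exact hB gs q.1 q.2 hq

/-! ### Integration over the group variables -/

/-- Each open face loses its heat kernel upon integration over its target variable. -/
theorem lintegral_prod_open_le {Q : Matrix (Fin D) (Fin D) ℝ} {C : ℝ}
    (hC : ∀ α : ℝ, 0 < α →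
      ∫⁻ θ, ENNReal.ofReal (heatKernel Q α θ) ∂torusHaar D ≤ ENNReal.ofReal C)
    {ι : Type*} [Fintype ι] (a : ι → ℝ) (ha : ∀ f, 0 < a f) (x : ι → Torus D) :
    ∫⁻ gt, ∏ f, ENNReal.ofReal (heatKernel Q (a f) (x f - gt f)) ∂(Measure.pi fun _ => torusHaar D)
      ≤ ENNReal.ofReal C ^ Fintype.card ι := by
  have hK : ∀ f, Measurable fun θ => ENNReal.ofReal (heatKernel Q (a f) θ) := fun f =>
    ((measurable_heatKernel Q).comp measurable_prodMk_left).ennreal_ofReal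
  rw [lintegral_pi_prod _ (fun f θ => ENNReal.ofReal (heatKernel Q (a f) (x f - θ)))
    fun f => (hK f).comp (measurable_const.sub measurable_id)]
  rw [← Finset.card_univ, ← Finset.prod_const]
  refine Finset.prod_le_prod' fun f _ => ?_
  rw [lintegral_sub_left_eq_self (fun θ => ENNReal.ofReal (heatKernel Q (a f) θ))]
  exact hC _ (ha f)

/-- The heat kernels of linearly independent faces are integrated out one by one, because the
holonomies of these faces are independent and Haar distributed. -/
theorem Orientation.lintegral_prod_closed_le (o : G.Orientation) {Q : Matrix (Fin D) (Fin D) ℝ}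
    {C : ℝ} (hC : ∀ α : ℝ, 0 < α →
      ∫⁻ θ, ENNReal.ofReal (heatKernel Q α θ) ∂torusHaar D ≤ ENNReal.ofReal C)
    (R : Finset G.ClosedFace) (hR : LinearIndependent ℚ fun f : R => o.row f.1)
    (a : G.ClosedFace → ℝ) (ha : ∀ f, 0 < a f) :
    ∫⁻ h, ∏ f ∈ R, ENNReal.ofReal (heatKernel Q (a f) (o.holonomy f.1 h))
        ∂(Measure.pi fun _ : G.Line => torusHaar D) ≤ ENNReal.ofReal C ^ R.card := by
  have hK : ∀ f : R, Measurable fun θ => ENNReal.ofReal (heatKernel Q (a f) θ) := fun f =>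
    ((measurable_heatKernel Q).comp measurable_prodMk_left).ennreal_ofReal
  have hmp := measurePreserving_holonomyHom D (fun e (f : R) => o.incidence e f.1.1) hR
  have h1 := hmp.lintegral_comp
    (f := fun y => ∏ f : R, ENNReal.ofReal (heatKernel Q (a f) (y f)))
    (Finset.measurable_fun_prod _ fun f _ => (hK f).comp (measurable_pi_apply f))
  have h2 : ∀ h : G.Line → Torus D,
      ∏ f ∈ R, ENNReal.ofReal (heatKernel Q (a f) (o.holonomy f.1 h)) =
      ∏ f : R, ENNReal.ofReal (heatKernel Q (a f)
        (holonomyHom D (fun e (f : R) => o.incidence e f.1.1) h f)) := fun h =>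
    (Finset.prod_coe_sort R fun f =>
      ENNReal.ofReal (heatKernel Q (a f) (o.holonomy f.1 h))).symm
  simp_rw [h2]
  rw [h1, lintegral_pi_prod _ (fun (f : R) θ => ENNReal.ofReal (heatKernel Q (a f) θ)) hK,
    ← Fintype.card_coe R, ← Finset.card_univ, ← Finset.prod_const]
  exact Finset.prod_le_prod' fun f _ => hC _ (ha f)

open scoped Classical in
/-- The bound on the integral over all variables: the closed faces outside `R` are bounded by their
supremum, all other faces are integrated. -/
theorem Orientation.lintegral_integrand_le (o : G.Orientation) {Q : Matrix (Fin D) (Fin D) ℝ}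
    {m M A C : ℝ} (hm : 0 < m) (hM : 1 < M) (hC1 : 1 ≤ C)
    (hA : ∀ i, ∫ a in schwingerSlice M i, Real.exp (-(m ^ 2 * a)) ≤ A * (M ^ (2 * i))⁻¹)
    (hsup : ∀ α b : ℝ, 1 ≤ b → (b ^ 2)⁻¹ ≤ α → ∀ θ : Torus D, heatKernel Q α θ ≤ C * b ^ D)
    (hmass : ∀ α : ℝ, 0 < α →
      ∫⁻ θ, ENNReal.ofReal (heatKernel Q α θ) ∂torusHaar D ≤ ENNReal.ofReal C)
    (μ : G.Line → ℕ) (gs : G.OpenFace → Torus D)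
    (R : Finset G.ClosedFace) (hR : LinearIndependent ℚ fun f : R => o.row f.1) :
    ∫⁻ q, ENNReal.ofReal (o.integrand Q m gs q.1 q.2)
        ∂((Measure.pi fun _ => torusHaar D).prod (lineMeasure G D M μ)) ≤
      ENNReal.ofReal ((∏ e, A * (M ^ (2 * μ e))⁻¹) *
        (C ^ Fintype.card G.Face * ∏ f ∈ Rᶜ, (M ^ f.1.scale μ) ^ D)) := by
  have hC0 : 0 ≤ C := by linarith
  have hM0 : 0 < M := by linarith
  set B := ∏ f ∈ Rᶜ, C * (M ^ f.1.scale μ) ^ D with hB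
  have hB0 : 0 ≤ B := Finset.prod_nonneg fun f _ => by positivity
  have hE0 : ∀ α : G.Line → ℝ, 0 ≤ ∏ e, Real.exp (-(m ^ 2 * α e)) := fun α =>
    Finset.prod_nonneg fun _ _ => (Real.exp_pos _).le
  have hK : ∀ α : ℝ, Measurable fun θ => ENNReal.ofReal (heatKernel Q α θ) := fun α =>
    ((measurable_heatKernel Q).comp measurable_prodMk_left).ennreal_ofReal
  have hF := (o.measurable_integrand Q m gs).ennreal_ofReal
  -- integration over the target variables
  have step1 : ∀ p : (G.Line → ℝ) × (G.Line → Torus D), (∀ e, p.1 e ∈ schwingerSlice M (μ e)) →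
      ∫⁻ gt, ENNReal.ofReal (o.integrand Q m gs gt p) ∂(Measure.pi fun _ => torusHaar D) ≤
        ENNReal.ofReal (∏ e, Real.exp (-(m ^ 2 * p.1 e))) *
        (∏ f : G.ClosedFace, ENNReal.ofReal (heatKernel Q (f.1.alpha p.1) (o.holonomy f.1 p.2))) *
        ENNReal.ofReal C ^ Fintype.card G.OpenFace := by
    intro p hp
    simp only [Orientation.integrand]
    simp_rw [ENNReal.ofReal_mul (mul_nonneg (hE0 p.1) (Finset.prod_nonneg
      fun _ _ => heatKernel_nonneg _ _ _)), ENNReal.ofReal_mul (hE0 p.1),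
      ENNReal.ofReal_prod_of_nonneg fun _ _ => heatKernel_nonneg Q _ _]
    rw [lintegral_const_mul' _ _ (ENNReal.mul_ne_top ENNReal.ofReal_ne_top
      (ENNReal.prod_ne_top fun _ _ => ENNReal.ofReal_ne_top))]
    gcongr
    exact lintegral_prod_open_le hmass (fun f : G.OpenFace => f.1.alpha p.1)
      (fun f => f.1.alpha_pos hM hp) (fun f => gs f + o.holonomy f.1 p.2)
  -- integration over the group variables of the lines
  have step2 : ∀ α : G.Line → ℝ, (∀ e, α e ∈ schwingerSlice M (μ e)) →
      ∫⁻ h, ∫⁻ gt, ENNReal.ofReal (o.integrand Q m gs gt (α, h))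
        ∂(Measure.pi fun _ => torusHaar D) ∂(Measure.pi fun _ => torusHaar D) ≤
      ENNReal.ofReal (∏ e, Real.exp (-(m ^ 2 * α e))) *
        ENNReal.ofReal (B * C ^ R.card * C ^ Fintype.card G.OpenFace) := by
    intro α hα
    refine (lintegral_mono fun h => step1 (α, h) hα).trans ?_
    have h1 : ∀ h : G.Line → Torus D,
        ∏ f : G.ClosedFace, ENNReal.ofReal (heatKernel Q (f.1.alpha α) (o.holonomy f.1 h)) ≤
        ENNReal.ofReal B *
          ∏ f ∈ R, ENNReal.ofReal (heatKernel Q (f.1.alpha α) (o.holonomy f.1 h)) := by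
      intro h
      rw [← Finset.prod_mul_prod_compl R, mul_comm, hB,
        ENNReal.ofReal_prod_of_nonneg fun f _ => by positivity]
      refine mul_le_mul_left (Finset.prod_le_prod' fun f _ => ENNReal.ofReal_le_ofReal ?_) _
      exact hsup _ _ (one_le_pow₀ hM.le) (f.1.inv_sq_le_alpha hα) _
    refine (lintegral_mono fun h => mul_le_mul_left (mul_le_mul_right (h1 h) _) _).trans ?_
    simp_rw [mul_assoc]
    rw [lintegral_const_mul' _ _ ENNReal.ofReal_ne_top, lintegral_const_mul' _ _
      ENNReal.ofReal_ne_top, lintegral_mul_const' _ _ (ENNReal.pow_ne_top ENNReal.ofReal_ne_top),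
      ENNReal.ofReal_mul hB0, ENNReal.ofReal_mul (by positivity), ENNReal.ofReal_pow hC0,
      ENNReal.ofReal_pow hC0]
    gcongr
    exact o.lintegral_prod_closed_le hmass R hR (fun f => f.1.alpha α)
      fun f => f.1.alpha_pos hM hα
  -- integration over the Schwinger parameters
  have step3 : ∫⁻ α, ENNReal.ofReal (∏ e, Real.exp (-(m ^ 2 * α e)))
      ∂(Measure.pi fun e => volume.restrict (schwingerSlice M (μ e))) ≤
      ENNReal.ofReal (∏ e, A * (M ^ (2 * μ e))⁻¹) := by
    rw [← ofReal_integral_eq_lintegral_ofReal (integrable_prod_exp G hm M μ)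
      (Filter.Eventually.of_forall hE0),
      integral_fintype_prod_eq_prod fun (_ : G.Line) a => Real.exp (-(m ^ 2 * a))]
    exact ENNReal.ofReal_le_ofReal (Finset.prod_le_prod
      (fun e _ => integral_nonneg fun a => (Real.exp_pos _).le) fun e _ => hA (μ e))
  rw [lintegral_prod_symm' _ hF, lineMeasure, lintegral_prod _ (Measurable.lintegral_prod_left'
    (μ := Measure.pi fun _ : G.OpenFace => torusHaar D) hF).aemeasurable]
  refine (lintegral_mono_ae ((ae_mem_schwingerSlice G M μ).mono step2)).trans ?_
  rw [lintegral_mul_const' _ _ ENNReal.ofReal_ne_top]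
  refine (mul_le_mul_left step3 _).trans ?_
  have hA0 : 0 ≤ ∏ e, A * (M ^ (2 * μ e))⁻¹ := Finset.prod_nonneg fun e _ =>
    (integral_nonneg fun a => (Real.exp_pos _).le).trans (hA (μ e))
  rw [← ENNReal.ofReal_mul hA0]
  refine ENNReal.ofReal_le_ofReal (mul_le_mul_of_nonneg_left (le_of_eq ?_) hA0)
  have hcard : Fintype.card G.Face = Rᶜ.card + R.card + Fintype.card G.OpenFace := by
    rw [Finset.card_compl_add_card, ← Fintype.card_sum]
    exact Fintype.card_congr (Equiv.sumCompl fun f : G.Face => f.IsClosed).symm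
  rw [hB, Finset.prod_mul_distrib, Finset.prod_const, hcard, pow_add, pow_add]
  ring

theorem Orientation.integrable_amplitude (o : G.Orientation) {Q : Matrix (Fin D) (Fin D) ℝ}
    (hQ : Q.PosDef) {m M : ℝ} (hm : 0 < m) (hM : 1 < M) (μ : G.Line → ℕ)
    (gs : G.OpenFace → Torus D) :
    Integrable (fun gt => o.amplitude Q m M μ gs gt) (Measure.pi fun _ => torusHaar D) :=
  (o.integrable_integrand_prod hQ hm hM μ gs).integral_prod_left

/-- The amplitude is nonnegative, so that the integral of its absolute value is that of the
integrand over all variables. -/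
theorem Orientation.integral_abs_amplitude_eq (o : G.Orientation) {Q : Matrix (Fin D) (Fin D) ℝ}
    (hQ : Q.PosDef) {m M : ℝ} (hm : 0 < m) (hM : 1 < M) (μ : G.Line → ℕ)
    (gs : G.OpenFace → Torus D) :
    ∫ gt, |o.amplitude Q m M μ gs gt| ∂(Measure.pi fun _ => torusHaar D) =
      (∫⁻ q, ENNReal.ofReal (o.integrand Q m gs q.1 q.2)
        ∂((Measure.pi fun _ => torusHaar D).prod (lineMeasure G D M μ))).toReal := by
  have hint := o.integrable_integrand_prod hQ hm hM μ gs
  have h0 : ∀ gt, |o.amplitude Q m M μ gs gt| =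
      ∫ p, o.integrand Q m gs gt p ∂(lineMeasure G D M μ) := fun gt =>
    abs_of_nonneg (integral_nonneg fun p => o.integrand_nonneg Q m gs gt p)
  rw [integral_congr_ae (Filter.Eventually.of_forall h0), ← integral_prod _ hint]
  exact integral_eq_lintegral_of_nonneg_ae
    (Filter.Eventually.of_forall fun q => o.integrand_nonneg Q m gs q.1 q.2)
    hint.aestronglyMeasurable

open scoped Classical in
/-- The multi-scale bound, from bounds on the slices and on the heat kernel. -/
theorem Orientation.integral_abs_amplitude_le (o : G.Orientation) {Q : Matrix (Fin D) (Fin D) ℝ}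
    (hQ : Q.PosDef) {m M A C : ℝ} (hm : 0 < m) (hM : 1 < M) (hA0 : 0 < A) (hC1 : 1 ≤ C)
    (hA : ∀ i, ∫ a in schwingerSlice M i, Real.exp (-(m ^ 2 * a)) ≤ A * (M ^ (2 * i))⁻¹)
    (hsup : ∀ α b : ℝ, 1 ≤ b → (b ^ 2)⁻¹ ≤ α → ∀ θ : Torus D, heatKernel Q α θ ≤ C * b ^ D)
    (hmass : ∀ α : ℝ, 0 < α →
      ∫⁻ θ, ENNReal.ofReal (heatKernel Q α θ) ∂torusHaar D ≤ ENNReal.ofReal C)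
    {ρ : ℕ} {μ : G.Line → ℕ} (hμ : ∀ e, μ e ≤ ρ) (gs : G.OpenFace → Torus D) :
    ∫ gt, |o.amplitude Q m M μ gs gt| ∂(Measure.pi fun _ => torusHaar D) ≤
      (A * C ^ d * M ^ 2) ^ Fintype.card G.Line *
        ∏ i ∈ Finset.range (ρ + 1), ∏ C ∈ components (highPart μ i),
          M ^ o.divergenceDegree D C := by
  have hM0 : 0 < M := by linarith
  have hC0 : 0 < C := by linarith
  obtain ⟨R, hR, hpow⟩ := o.exists_linearIndepOn_power_counting D hM hμ
  have hbound := o.lintegral_integrand_le hm hM hC1 hA hsup hmass μ gs R hR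
  rw [o.integral_abs_amplitude_eq hQ hm hM μ gs]
  generalize ∏ i ∈ Finset.range (ρ + 1), ∏ C ∈ components (highPart μ i),
    M ^ o.divergenceDegree D C = W at hpow ⊢
  have hS0 : 0 ≤ ∏ f ∈ Rᶜ, (M ^ f.1.scale μ) ^ D :=
    Finset.prod_nonneg fun f _ => by positivity
  have hT0 : 0 ≤ ∏ e, (M ^ (2 * μ e))⁻¹ := Finset.prod_nonneg fun e _ => by positivity
  rw [Finset.prod_mul_distrib, Finset.prod_const, Finset.card_univ] at hbound
  generalize ∏ f ∈ Rᶜ, (M ^ f.1.scale μ) ^ D = S at hpow hbound hS0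
  generalize ∏ e, (M ^ (2 * μ e))⁻¹ = T at hpow hbound hT0
  have hCard : C ^ Fintype.card G.Face ≤ (C ^ d) ^ Fintype.card G.Line := by
    rw [← pow_mul]
    exact pow_le_pow_right₀ hC1 G.card_face_le
  refine (ENNReal.toReal_le_of_le_ofReal (by positivity) hbound).trans ?_
  calc A ^ Fintype.card G.Line * T * (C ^ Fintype.card G.Face * S)
      ≤ A ^ Fintype.card G.Line * T * ((C ^ d) ^ Fintype.card G.Line * S) := by
        gcongr
    _ = (A * C ^ d) ^ Fintype.card G.Line * (T * S) := by
        rw [mul_pow]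
        ring
    _ ≤ (A * C ^ d) ^ Fintype.card G.Line * ((M ^ 2) ^ Fintype.card G.Line * W) :=
        mul_le_mul_of_nonneg_left hpow (by positivity)
    _ = _ := by
        rw [mul_pow (A * C ^ d), mul_assoc]

end TensorGraph

end

theorem mainTheorem4 (d D : ℕ) (Q : Matrix (Fin D) (Fin D) ℝ) (hQ : Q.PosDef)
    (m M : ℝ) (hm : 0 < m) (hM : 1 < M) :
    ∃ K : ℝ, 0 < K ∧
      ∀ (G : TensorGraph d) (o : G.Orientation) (ρ : ℕ) (μ : G.Line → ℕ), (∀ e, μ e ≤ ρ) →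
        ∀ gs : G.OpenFace → Torus D,
          (∀ gt : G.OpenFace → Torus D, MeasureTheory.Integrable (o.integrand Q m gs gt)
            (TensorGraph.lineMeasure G D M μ)) ∧
          MeasureTheory.Integrable (fun gt : G.OpenFace → Torus D => o.amplitude Q m M μ gs gt)
            (MeasureTheory.Measure.pi fun _ => torusHaar D) ∧
          ∫ gt : G.OpenFace → Torus D, |o.amplitude Q m M μ gs gt|
              ∂(MeasureTheory.Measure.pi fun _ => torusHaar D)
            ≤ K ^ Fintype.card G.Line *
              ∏ i ∈ Finset.range (ρ + 1),
                ∏ C ∈ TensorGraph.components (TensorGraph.highPart μ i),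
                  M ^ o.divergenceDegree D C := by
  obtain ⟨A, hA0, hA⟩ := exists_integral_exp_schwingerSlice_le hm hM
  obtain ⟨C₁, hC₁, hsup⟩ := exists_heatKernel_le hQ
  obtain ⟨C₂, hC₂, hmass⟩ := exists_lintegral_heatKernel_le hQ
  have hC1 : 1 ≤ max C₁ C₂ := hC₁.trans (le_max_left _ _)
  refine ⟨A * max C₁ C₂ ^ d * M ^ 2, by positivity, fun G o ρ μ hμ gs =>
    ⟨o.integrable_integrand hQ hm hM μ gs, o.integrable_amplitude hQ hm hM μ gs, ?_⟩⟩
  refine o.integral_abs_amplitude_le hQ hm hM hA0 hC1 hA (fun α b hb hα θ => ?_)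
    (fun α hα => (hmass α hα).trans (ENNReal.ofReal_le_ofReal (le_max_right _ _))) hμ gs
  exact (hsup α b hb hα θ).trans
    (mul_le_mul_of_nonneg_right (le_max_left _ _) (pow_nonneg (by linarith) D))
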